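/- **Consistency error of the streamline diffusion method (SDFEM).** *Problem.* Let $d\ge 2$ and let $\Omega\subset\mathbb R^d$ be a bounded polygonal (polyhedral) domain with Lipschitz boundary $\Gamma=\Gamma_D\cup\Gamma_N$, $\Gamma_N=\Gamma\setminus\Gamma_D$. Let $\varepsilon>0$, $a\in W^{1,\infty}(\Omega)^d$, $b\in L^\infty(\Omega)$, $f\in L^2(\Omega)$, $g\in L^2(\Gamma_N)$, and let $\beta,c_b\ge 0$ satisfy $-\frac12\operatorname{div}a+b\ge\beta$ and $\|b\|_{L^\infty(\Omega)}\le c_b\beta$. Let $\Gamma_D$ have positive $(d-1)$-dimensional Hausdorff measure and contain the inflow boundary $\{x\in\Gamma: a(x)\cdot n(x)<0\}$, where $n$ is the exterior unit normal. Let $H^1_D(\Omega)$ be the space of $H^1(\Omega)$-functions with vanishing trace on $\Gamma_D$; for $v,w\in H^1_D(\Omega)$ put $$B(w,v)=\int_\Omega\{\varepsilon\nabla w\cdot\nabla v+a\cdot\nabla w\,v+bwv\},\qquad \langle\ell,v\rangle=\int_\Omega fv+\int_{\Gamma_N}gv,$$ $$|||v|||=\{\varepsilon\|\nabla v\|_\Omega^2+\beta\|v\|_\Omega^2\}^{1/2},\qquad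 |||\varphi|||_*=\sup_{v\in H^1_D(\Omega)\setminus\{0\}}\frac{\langle\varphi,v\rangle}{|||v|||},$$ where $\|\cdot\|_\omega$ is the $L^2(\omega)$-norm. *Partition.* Let $\mathcal T$ be a finite set of simplices and parallelepipeds $K$, each the image $K=F_K(\widehat K)$ of the reference simplex or cube under an affine bijection, with union $\overline\Omega$, such that $\Gamma_D$ is a union of $(d-1)$-dimensional faces of elements, every element has a vertex in $\Omega\cup\Gamma_N$, and any two distinct elements are disjoint or intersect in a complete lower dimensional face of both. Let $h_\omega$ denote the diameter of $\omega$ and $\rho_K$ the diameter of the largest ball in $K$, and let $\sigma=\max_K h_K/\rho_K$ be the shape parameter. For an element or face $A$, $\widetilde\omega_A$ is the union of all elements meeting $A$. Fix $S\in\{P,Q\}$. $S_k(K)$ consists of the functions $\varphi\circ F_K^{-1}$ with $\varphi$ a polynomial of total degree $\le k$ if $S=P$ or $K$ is a simplex, and of maximal degree $\le k$ in each variable if $S=Q$ and $K$ is a parallelepiped. $S^{k,-1}(\mathcal T)$ is the space of functions which on every $K$ belong to $S_k(K)$, and $S_D^{k,0}(\mathcal T)=S^{k,-1}(\mathcal T)\cap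 C(\overline\Omega)\cap H^1_D(\Omega)$. *Method.* Let $l\ge k\ge1$, let $V(\mathcal T)$ be a linear space with $S_D^{k,0}(\mathcal T)\subset V(\mathcal T)\subset S_D^{l,0}(\mathcal T)$, and let $\vartheta_K\ge0$ and $c_S$ satisfy $\vartheta_K\|a\|_{\infty,K}\le c_Sh_K$ for all $K\in\mathcal T$. Let $u_{\mathcal T}\in V(\mathcal T)$ satisfy, for all $v_{\mathcal T}\in V(\mathcal T)$, $$B(u_{\mathcal T},v_{\mathcal T})+\sum_{K\in\mathcal T}\vartheta_K\int_K\{-\varepsilon\Delta u_{\mathcal T}+a\cdot\nabla u_{\mathcal T}+bu_{\mathcal T}-f\}\,a\cdot\nabla v_{\mathcal T}=\langle\ell,v_{\mathcal T}\rangle .$$ Its residual is $\langle R,v\rangle=\langle\ell,v\rangle-B(u_{\mathcal T},v)$ for $v\in H^1_D(\Omega)$. *Constants.* Let $I_{\mathcal T}:H^1_D(\Omega)\to S^{1,0}_D(\mathcal T)$ be a linear operator such that for all $v\in H^1_D(\Omega)$, all elements $K$ and all $(d-1)$-dimensional faces $F$ thereof $$\|v-I_{\mathcal T}v\|_K\le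 c_1\|v\|_{\widetilde\omega_K},\quad \|v-I_{\mathcal T}v\|_K\le c_2h_K\|\nabla v\|_{\widetilde\omega_K},$$ $$\|\nabla(v-I_{\mathcal T}v)\|_K\le c_3\|\nabla v\|_{\widetilde\omega_K},\quad \|v-I_{\mathcal T}v\|_F\le c_4h_F^{1/2}\|\nabla v\|_{\widetilde\omega_F},$$ and set $\langle I_{\mathcal T}^*\varphi,v\rangle=\langle\varphi,I_{\mathcal T}v\rangle$. Let $c_I$ be a constant of the inverse estimate $$\|\nabla w_{\mathcal T}\|_K\le c_Ih_K^{-1}\|w_{\mathcal T}\|_{\widetilde\omega_K}\qquad\text{for all }w_{\mathcal T}\in S_D^{1,0}(\mathcal T),\ K\in\mathcal T;$$ such a constant exists for every $\mathcal T$. *Indicators.* Put $\hbar_\omega=\min\{\varepsilon^{-1/2}h_\omega,\beta^{-1/2}\}$ if $\beta>0$ and $\hbar_\omega=\varepsilon^{-1/2}h_\omega$ if $\beta=0$. Let the components of $f_{\mathcal T},a_{\mathcal T},b_{\mathcal T}$ be in $S^{m,-1}(\mathcal T)$ and let $g_{\mathcal E}$ be piecewise in $S_m$ on the faces, for some $m\ge0$.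 For $K\in\mathcal T$ let $\mathcal E_{K,\Omega}$ and $\mathcal E_{K,\Gamma_N}$ be the sets of its interior $(d-1)$-dimensional faces and of those on the Neumann boundary, $n_E$ a unit normal to $E$ (exterior to $\Omega$ on $\Gamma$), $\mathbb J_E$ the jump across $E$, and $$\begin{aligned}\eta_K^2={}&\hbar_K^2\|f_{\mathcal T}+\varepsilon\Delta u_{\mathcal T}-a_{\mathcal T}\cdot\nabla u_{\mathcal T}-b_{\mathcal T}u_{\mathcal T}\|_K^2+\tfrac12\sum_{E\in\mathcal E_{K,\Omega}}\varepsilon^{-1/2}\hbar_E\|\mathbb J_E(\varepsilon n_E\cdot\nabla u_{\mathcal T})\|_E^2\\&+\sum_{E\in\mathcal E_{K,\Gamma_N}}\varepsilon^{-1/2}\hbar_E\|g_{\mathcal E}-\varepsilon n_E\cdot\nabla u_{\mathcal T}\|_E^2,\\ \theta_K^2={}&\hbar_K^2\|f-f_{\mathcal T}+(a_{\mathcal T}-a)\cdot\nabla u_{\mathcal T}+(b_{\mathcal T}-b)u_{\mathcal T}\|_K^2+\sum_{E\in\mathcal E_{K,\Gamma_N}}\varepsilon^{-1/2}\hbar_E\|g-g_{\mathcal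 E}\|_E^2.\end{aligned}$$ *Claim.* For every $d\ge2$ there is a constant $c$, depending only on $d$, $c_S$, $c_1,\dots,c_4$, $c_I$ and $\sigma$ (in particular not on $\varepsilon$ and $\beta$), such that in this situation $$|||I_{\mathcal T}^*R|||_*\le c\,\Big\{\sum_{K\in\mathcal T}\big[\eta_K^2+\theta_K^2\big]\Big\}^{1/2}.$$ -/

import Mathlib

open MeasureTheory Filter Topology
open scoped ENNReal NNReal ContDiff InnerProductSpace Gradient Laplacian

noncomputable section

namespace ConvDiff

/-- The space `ℝ^d` with the Euclidean norm. -/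
abbrev Vec (d : ℕ) : Type := EuclideanSpace ℝ (Fin d)

/-- The `(d-1)`-dimensional surface measure in `ℝ^d`: the Hausdorff measure with the Euclidean
normalization. -/
def surf (d : ℕ) : Measure (Vec d) := μHE[d - 1]

/-- The `L²`-norm with respect to a measure. -/
def normL2 {X F : Type*} [MeasurableSpace X] [NormedAddCommGroup F] (μ : Measure X) (f : X → F) :
    ℝ := (eLpNorm f 2 μ).toReal

/-- The `L^∞`-norm with respect to a measure. -/
def normLinf {X F : Type*} [MeasurableSpace X] [NormedAddCommGroup F] (μ : Measure X)
    (f : X → F) : ℝ := (eLpNorm f ⊤ μ).toReal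

/-! ### Domains, weak gradients, traces and the spaces `H¹(Ω)`, `H¹_D(Ω)` -/

/-- `Ω` has a Lipschitz boundary: near every boundary point, in a suitable orthonormal coordinate
system with last axis `e`, the set `Ω` is the region strictly below the graph of a Lipschitz
function (of the component orthogonal to `e`). -/
def HasLipschitzBoundary {d : ℕ} (Ω : Set (Vec d)) : Prop :=
  ∀ x ∈ frontier Ω, ∃ r : ℝ, 0 < r ∧ ∃ e : Vec d, ‖e‖ = 1 ∧
    ∃ (L : ℝ≥0) (γ : Vec d → ℝ), LipschitzWith L γ ∧
      ∀ y ∈ Metric.ball x r, (y ∈ Ω ↔ ⟪e, y⟫_ℝ < γ (y - ⟪e, y⟫_ℝ • e))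

/-- `n` is the exterior unit normal to `Ω` at a point `x` near which the boundary is flat. In a
polygonal domain this covers every boundary point at which an exterior normal exists. -/
def IsExteriorNormal {d : ℕ} (Ω : Set (Vec d)) (x n : Vec d) : Prop :=
  ‖n‖ = 1 ∧ ∃ r : ℝ, 0 < r ∧ ∀ y ∈ Metric.ball x r, (y ∈ Ω ↔ ⟪n, y - x⟫_ℝ < 0)

/-- `g` is the weak gradient of `u` in `Ω`. -/
def HasWeakGradient {d : ℕ} (Ω : Set (Vec d)) (u : Vec d → ℝ) (g : Vec d → Vec d) : Prop :=
  ∀ φ : Vec d → ℝ, ContDiff ℝ ∞ φ → HasCompactSupport φ → tsupport φ ⊆ Ω →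
    ∀ w : Vec d, ∫ x in Ω, u x * fderiv ℝ φ x w = - ∫ x in Ω, ⟪g x, w⟫_ℝ * φ x

/-- `τ ∈ L²(S)` is the trace on the surface `S ⊆ closure Ω` of the `H¹(Ω)`-function `v` with weak
gradient `g`: there are smooth functions converging to `v` in `H¹(Ω)` whose restrictions to `S`
converge to `τ` in `L²(S)`. -/
def HasTrace {d : ℕ} (Ω S : Set (Vec d)) (v : Vec d → ℝ) (g : Vec d → Vec d) (τ : Vec d → ℝ) :
    Prop :=
  MemLp τ 2 ((surf d).restrict S) ∧
  ∃ φ : ℕ → Vec d → ℝ, (∀ n, ContDiff ℝ ∞ (φ n)) ∧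
    Tendsto (fun n => eLpNorm (fun x => φ n x - v x) 2 (volume.restrict Ω)) atTop (𝓝 0) ∧
    Tendsto (fun n => eLpNorm (fun x => ∇ (φ n) x - g x) 2 (volume.restrict Ω)) atTop (𝓝 0) ∧
    Tendsto (fun n => eLpNorm (fun x => φ n x - τ x) 2 ((surf d).restrict S)) atTop (𝓝 0)

/-- `L²(Ω; F)`. -/
abbrev L2 {d : ℕ} (Ω : Set (Vec d)) (F : Type) [NormedAddCommGroup F] : Type :=
  Lp F 2 ((volume : Measure (Vec d)).restrict Ω)

theorem integrableOn_mul_test {d : ℕ} {Ω : Set (Vec d)} (u : L2 Ω ℝ) {ψ : Vec d → ℝ}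
    (hψ : Continuous ψ) (hc : HasCompactSupport ψ) : IntegrableOn (fun x => u x * ψ x) Ω :=
  (Lp.memLp u).integrable_mul (q := 2) ((hψ.memLp_of_hasCompactSupport hc).restrict Ω)

theorem HasWeakGradient.add {d : ℕ} {Ω : Set (Vec d)} {p q : L2 Ω ℝ × L2 Ω (Vec d)}
    (hp : HasWeakGradient Ω p.1 p.2) (hq : HasWeakGradient Ω q.1 q.2) :
    HasWeakGradient Ω (p + q).1 (p + q).2 := by
  intro φ h1 h2 h3 w
  have hd : Continuous fun x => fderiv ℝ φ x w := by
    have := h1.continuous_fderiv (by simp)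
    fun_prop
  have hdc : HasCompactSupport fun x => fderiv ℝ φ x w := h2.fderiv_apply ℝ w
  have hg : ∀ g : L2 Ω (Vec d), IntegrableOn (fun x => ⟪g x, w⟫_ℝ * φ x) Ω := fun g =>
    ((Lp.memLp g).inner_const w).integrable_mul (q := 2)
      ((h1.continuous.memLp_of_hasCompactSupport h2).restrict Ω)
  have e1 : ∫ x in Ω, (p + q).1 x * fderiv ℝ φ x w
      = ∫ x in Ω, (p.1 x * fderiv ℝ φ x w + q.1 x * fderiv ℝ φ x w) := by
    refine integral_congr_ae ?_
    filter_upwards [Lp.coeFn_add p.1 q.1] with x hx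
    rw [Prod.fst_add, hx, Pi.add_apply, add_mul]
  have e2 : ∫ x in Ω, ⟪(p + q).2 x, w⟫_ℝ * φ x
      = ∫ x in Ω, (⟪p.2 x, w⟫_ℝ * φ x + ⟪q.2 x, w⟫_ℝ * φ x) := by
    refine integral_congr_ae ?_
    filter_upwards [Lp.coeFn_add p.2 q.2] with x hx
    rw [Prod.snd_add, hx, Pi.add_apply, inner_add_left, add_mul]
  rw [e1, e2, integral_add (integrableOn_mul_test p.1 hd hdc) (integrableOn_mul_test q.1 hd hdc),
    integral_add (hg _) (hg _), hp φ h1 h2 h3 w, hq φ h1 h2 h3 w]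
  ring

theorem HasWeakGradient.smul {d : ℕ} {Ω : Set (Vec d)} {p : L2 Ω ℝ × L2 Ω (Vec d)} (c : ℝ)
    (hp : HasWeakGradient Ω p.1 p.2) : HasWeakGradient Ω (c • p).1 (c • p).2 := by
  intro φ h1 h2 h3 w
  have e1 : ∫ x in Ω, (c • p).1 x * fderiv ℝ φ x w
      = ∫ x in Ω, c * (p.1 x * fderiv ℝ φ x w) := by
    refine integral_congr_ae ?_
    filter_upwards [Lp.coeFn_smul c p.1] with x hx
    rw [Prod.smul_fst, hx, Pi.smul_apply, smul_eq_mul, mul_assoc]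
  have e2 : ∫ x in Ω, ⟪(c • p).2 x, w⟫_ℝ * φ x = ∫ x in Ω, c * (⟪p.2 x, w⟫_ℝ * φ x) := by
    refine integral_congr_ae ?_
    filter_upwards [Lp.coeFn_smul c p.2] with x hx
    rw [Prod.smul_snd, hx, Pi.smul_apply, real_inner_smul_left, mul_assoc]
  rw [e1, e2, integral_const_mul, integral_const_mul, hp φ h1 h2 h3 w]
  ring

/-- The Sobolev space `H¹(Ω)`: an element is an `L²(Ω)`-function together with its (unique) weak
gradient in `L²(Ω)^d`. -/
def H1 {d : ℕ} (Ω : Set (Vec d)) : Submodule ℝ (L2 Ω ℝ × L2 Ω (Vec d)) where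
  carrier := {p | HasWeakGradient Ω p.1 p.2}
  add_mem' := fun hp hq => HasWeakGradient.add hp hq
  zero_mem' := by
    intro φ h1 h2 h3 w
    have e1 : ∫ x in Ω, (0 : L2 Ω ℝ × L2 Ω (Vec d)).1 x * fderiv ℝ φ x w = ∫ x in Ω, (0 : ℝ) := by
      refine integral_congr_ae ?_
      filter_upwards [Lp.coeFn_zero ℝ 2 (volume.restrict Ω)] with x hx
      rw [Prod.fst_zero, hx, Pi.zero_apply, zero_mul]
    have e2 : ∫ x in Ω, ⟪(0 : L2 Ω ℝ × L2 Ω (Vec d)).2 x, w⟫_ℝ * φ x = ∫ x in Ω, (0 : ℝ) := by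
      refine integral_congr_ae ?_
      filter_upwards [Lp.coeFn_zero (Vec d) 2 (volume.restrict Ω)] with x hx
      rw [Prod.snd_zero, hx, Pi.zero_apply, inner_zero_left, zero_mul]
    rw [e1, e2]
    simp
  smul_mem' := fun c _ hp => HasWeakGradient.smul c hp

theorem tendsto_eLpNorm_add {X F : Type*} [MeasurableSpace X] [NormedAddCommGroup F]
    {μ : Measure X} {f g : ℕ → X → F} (hf : ∀ n, AEStronglyMeasurable (f n) μ)
    (hg : ∀ n, AEStronglyMeasurable (g n) μ)
    (h1 : Tendsto (fun n => eLpNorm (f n) 2 μ) atTop (𝓝 0))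
    (h2 : Tendsto (fun n => eLpNorm (g n) 2 μ) atTop (𝓝 0)) {k : ℕ → X → F}
    (hk : ∀ n, k n =ᵐ[μ] f n + g n) : Tendsto (fun n => eLpNorm (k n) 2 μ) atTop (𝓝 0) := by
  have h := h1.add h2
  rw [add_zero] at h
  refine tendsto_of_tendsto_of_tendsto_of_le_of_le tendsto_const_nhds h (fun _ => zero_le) ?_
  intro n
  simp only []
  rw [eLpNorm_congr_ae (hk n)]
  exact eLpNorm_add_le (hf n) (hg n) (by norm_num)

theorem tendsto_eLpNorm_smul {X F : Type*} [MeasurableSpace X] [NormedAddCommGroup F]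
    [NormedSpace ℝ F] {μ : Measure X} {f : ℕ → X → F} (c : ℝ)
    (h1 : Tendsto (fun n => eLpNorm (f n) 2 μ) atTop (𝓝 0)) {k : ℕ → X → F}
    (hk : ∀ n, k n =ᵐ[μ] c • f n) : Tendsto (fun n => eLpNorm (k n) 2 μ) atTop (𝓝 0) := by
  have h := ENNReal.Tendsto.const_mul (a := ‖c‖ₑ) h1 (Or.inr enorm_ne_top)
  rw [mul_zero] at h
  refine h.congr fun n => ?_
  rw [eLpNorm_congr_ae (hk n), eLpNorm_const_smul]

theorem continuous_gradient {d : ℕ} {φ : Vec d → ℝ} (h : ContDiff ℝ ∞ φ) :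
    Continuous (∇ φ) :=
  (InnerProductSpace.toDual ℝ (Vec d)).symm.continuous.comp (h.continuous_fderiv (by simp))

theorem HasTrace.add_zero {d : ℕ} {Ω S : Set (Vec d)} {p q : L2 Ω ℝ × L2 Ω (Vec d)}
    (hp : HasTrace Ω S p.1 p.2 0) (hq : HasTrace Ω S q.1 q.2 0) :
    HasTrace Ω S (p + q).1 (p + q).2 0 := by
  obtain ⟨_, φ, hφ, a1, a2, a3⟩ := hp
  obtain ⟨_, ψ, hψ, b1, b2, b3⟩ := hq
  refine ⟨MemLp.zero, fun n x => φ n x + ψ n x, fun n => (hφ n).add (hψ n), ?_, ?_, ?_⟩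
  · refine tendsto_eLpNorm_add
      (fun n => ((hφ n).continuous.aestronglyMeasurable.sub (Lp.aestronglyMeasurable p.1)))
      (fun n => ((hψ n).continuous.aestronglyMeasurable.sub (Lp.aestronglyMeasurable q.1)))
      a1 b1 fun n => ?_
    filter_upwards [Lp.coeFn_add p.1 q.1] with x hx
    simp only [Prod.fst_add, hx, Pi.add_apply, Pi.sub_apply]
    ring
  · refine tendsto_eLpNorm_add
      (fun n => ((continuous_gradient (hφ n)).aestronglyMeasurable.sub
        (Lp.aestronglyMeasurable p.2)))
      (fun n => ((continuous_gradient (hψ n)).aestronglyMeasurable.sub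
        (Lp.aestronglyMeasurable q.2)))
      a2 b2 fun n => ?_
    filter_upwards [Lp.coeFn_add p.2 q.2] with x hx
    have : ∇ (fun x => φ n x + ψ n x) x = ∇ (φ n) x + ∇ (ψ n) x := by
      unfold gradient
      rw [fderiv_fun_add ((hφ n).differentiable (by simp) x) ((hψ n).differentiable (by simp) x),
        map_add]
    simp only [Prod.snd_add, hx, Pi.add_apply, Pi.sub_apply, this]
    abel
  · refine tendsto_eLpNorm_add
      (fun n => ((hφ n).continuous.aestronglyMeasurable.sub aestronglyMeasurable_zero))
      (fun n => ((hψ n).continuous.aestronglyMeasurable.sub aestronglyMeasurable_zero))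
      a3 b3 fun n => ?_
    filter_upwards with x
    simp

theorem HasTrace.smul_zero {d : ℕ} {Ω S : Set (Vec d)} {p : L2 Ω ℝ × L2 Ω (Vec d)} (c : ℝ)
    (hp : HasTrace Ω S p.1 p.2 0) : HasTrace Ω S (c • p).1 (c • p).2 0 := by
  obtain ⟨_, φ, hφ, a1, a2, a3⟩ := hp
  refine ⟨MemLp.zero, fun n x => c * φ n x, fun n => contDiff_const.mul (hφ n), ?_, ?_, ?_⟩
  · refine tendsto_eLpNorm_smul c a1 fun n => ?_
    filter_upwards [Lp.coeFn_smul c p.1] with x hx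
    simp only [Prod.smul_fst, hx, Pi.smul_apply, smul_eq_mul]
    ring
  · refine tendsto_eLpNorm_smul c a2 fun n => ?_
    filter_upwards [Lp.coeFn_smul c p.2] with x hx
    have : ∇ (fun x => c * φ n x) x = c • ∇ (φ n) x := by
      unfold gradient
      rw [fderiv_const_mul ((hφ n).differentiable (by simp) x), map_smulₛₗ]
      simp
    simp only [Prod.smul_snd, hx, Pi.smul_apply, this, smul_sub]
  · refine tendsto_eLpNorm_smul c a3 fun n => ?_
    filter_upwards with x
    simp

theorem HasTrace.zero {d : ℕ} (Ω S : Set (Vec d)) :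
    HasTrace Ω S (0 : L2 Ω ℝ × L2 Ω (Vec d)).1 (0 : L2 Ω ℝ × L2 Ω (Vec d)).2 0 := by
  refine ⟨MemLp.zero, fun _ _ => 0, fun n => contDiff_const, ?_, ?_, ?_⟩
  · refine tendsto_const_nhds.congr fun n => ?_
    rw [eLpNorm_congr_ae (g := 0), eLpNorm_zero]
    filter_upwards [Lp.coeFn_zero ℝ 2 (volume.restrict Ω)] with x hx
    simp only [Prod.fst_zero, hx, Pi.zero_apply, sub_zero]
  · refine tendsto_const_nhds.congr fun n => ?_
    rw [eLpNorm_congr_ae (g := 0), eLpNorm_zero]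
    filter_upwards [Lp.coeFn_zero (Vec d) 2 (volume.restrict Ω)] with x hx
    simp only [Prod.snd_zero, hx, Pi.zero_apply, sub_zero]
    simp [gradient]
  · simp

/-- `H¹_D(Ω)`: the functions in `H¹(Ω)` whose trace on `Γ_D` vanishes. -/
def H1D {d : ℕ} (Ω ΓD : Set (Vec d)) : Submodule ℝ (L2 Ω ℝ × L2 Ω (Vec d)) where
  carrier := {p | p ∈ H1 Ω ∧ HasTrace Ω ΓD p.1 p.2 0}
  add_mem' := fun hp hq => ⟨(H1 Ω).add_mem hp.1 hq.1, HasTrace.add_zero hp.2 hq.2⟩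
  zero_mem' := ⟨(H1 Ω).zero_mem, HasTrace.zero Ω ΓD⟩
  smul_mem' := fun c _ hp => ⟨(H1 Ω).smul_mem c hp.1, HasTrace.smul_zero c hp.2⟩

section
variable {d : ℕ} {Ω ΓD : Set (Vec d)}

/-- The function underlying an element of `H¹_D(Ω)`. -/
def fnOf (v : H1D Ω ΓD) : Vec d → ℝ := v.1.1

/-- The weak gradient of an element of `H¹_D(Ω)`. -/
def gradOf (v : H1D Ω ΓD) : Vec d → Vec d := v.1.2

open Classical in
/-- The trace of `v` on a surface `S ⊆ closure Ω`; unique as an element of `L²(S)`. -/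
def traceOf (S : Set (Vec d)) (v : H1D Ω ΓD) : Vec d → ℝ :=
  if h : ∃ τ, HasTrace Ω S (fnOf v) (gradOf v) τ then h.choose else 0

end

/-! ### The convection-diffusion problem -/

/-- The data of the problem `-ε Δu + a·∇u + b u = f` in `Ω`, `u = 0` on `Γ_D`,
`ε ∂u/∂n = g` on `Γ_N`, with the standing assumptions. -/
structure Problem (d : ℕ) where
  /-- the domain -/
  Ω : Set (Vec d)
  /-- the Dirichlet boundary; the Neumann boundary is the rest of the boundary -/
  ΓD : Set (Vec d)
  /-- the diffusion parameter -/
  ε : ℝ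
  /-- the convection field (its continuous representative) -/
  a : Vec d → Vec d
  /-- the weak gradients of the components of the convection field -/
  gradA : Fin d → Vec d → Vec d
  /-- the reaction coefficient -/
  b : Vec d → ℝ
  /-- the right-hand side -/
  f : Vec d → ℝ
  /-- the Neumann datum -/
  g : Vec d → ℝ
  β : ℝ
  c_b : ℝ
  isOpen_Ω : IsOpen Ω
  isConnected_Ω : IsConnected Ω
  isBounded_Ω : Bornology.IsBounded Ω
  lipschitz_Ω : HasLipschitzBoundary Ω
  ΓD_subset : ΓD ⊆ frontier Ω
  ε_pos : 0 < ε
  continuousOn_a : ContinuousOn a (closure Ω)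
  memLp_a : MemLp a ⊤ (volume.restrict Ω)
  memLp_gradA : ∀ j, MemLp (gradA j) ⊤ (volume.restrict Ω)
  weakGradient_a : ∀ j, HasWeakGradient Ω (fun x => a x j) (gradA j)
  memLp_b : MemLp b ⊤ (volume.restrict Ω)
  memLp_f : MemLp f 2 (volume.restrict Ω)
  memLp_g : MemLp g 2 ((surf d).restrict (frontier Ω \ ΓD))
  β_nonneg : 0 ≤ β
  c_b_nonneg : 0 ≤ c_b
  coercive : ∀ᵐ x ∂(volume.restrict Ω), β ≤ -(1 / 2) * (∑ j, gradA j x j) + b x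
  norm_b_le : normLinf (volume.restrict Ω) b ≤ c_b * β
  surf_ΓD_pos : 0 < surf d ΓD
  inflow : ∀ x ∈ frontier Ω, ∀ n, IsExteriorNormal Ω x n → ⟪a x, n⟫_ℝ < 0 → x ∈ ΓD

namespace Problem
variable {d : ℕ} (D : Problem d)

/-- The Neumann boundary. -/
def ΓN : Set (Vec d) := frontier D.Ω \ D.ΓD

/-- The space `H¹_D(Ω)` of the problem. -/
abbrev V : Submodule ℝ (L2 D.Ω ℝ × L2 D.Ω (Vec d)) := H1D D.Ω D.ΓD

/-- Lebesgue measure on the part of `Ω` in `A`. -/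
def vol (A : Set (Vec d)) : Measure (Vec d) := (volume.restrict D.Ω).restrict A

/-- The bilinear form `B`. -/
def B (u v : D.V) : ℝ :=
  ∫ x in D.Ω, (D.ε * ⟪gradOf u x, gradOf v x⟫_ℝ + ⟪D.a x, gradOf u x⟫_ℝ * fnOf v x
    + D.b x * fnOf u x * fnOf v x)

/-- The linear functional `ℓ`. -/
def ell (v : D.V) : ℝ :=
  (∫ x in D.Ω, D.f x * fnOf v x) + ∫ x in D.ΓN, D.g x * traceOf D.ΓN v x ∂(surf d)

/-- The energy norm. -/
def normE (v : D.V) : ℝ :=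
  √(D.ε * normL2 (volume.restrict D.Ω) (gradOf v) ^ 2 + D.β * normL2 (volume.restrict D.Ω) (fnOf v) ^ 2)

/-- The dual norm of a functional on `H¹_D(Ω)`, as an extended real number. -/
def normDual (φ : D.V → ℝ) : EReal := ⨆ v : {v : D.V // v ≠ 0}, ((φ v / D.normE v : ℝ) : EReal)

/-- The residual of `w ∈ H¹_D(Ω)`. -/
def residual (w : D.V) (v : D.V) : ℝ := D.ell v - D.B w v

/-- The weight `ħ_A`. -/
def hbar (A : Set (Vec d)) : ℝ :=
  if 0 < D.β then min (D.ε ^ (-(1 / 2) : ℝ) * Metric.diam A) (D.β ^ (-(1 / 2) : ℝ))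
  else D.ε ^ (-(1 / 2) : ℝ) * Metric.diam A

end Problem

/-- The adjoint `I*` of an operator `I`, acting on functionals. -/
def adjoint {W : Type*} (I : W → W) (φ : W → ℝ) : W → ℝ := fun v => φ (I v)

/-! ### Partitions -/

/-- The two kinds of reference elements. -/
inductive RefKind
  | simplex
  | cube

/-- The reference simplex and the reference cube. -/
def refCell (d : ℕ) : RefKind → Set (Vec d)
  | .simplex => {x | (∀ i, 0 ≤ x i) ∧ ∑ i, x i ≤ 1}
  | .cube => {x | ∀ i, 0 ≤ x i ∧ x i ≤ 1}

open Classical in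
/-- The `(d-1)`-dimensional faces of the reference elements. -/
def refFacets (d : ℕ) : RefKind → Finset (Set (Vec d))
  | .simplex => insert {x | x ∈ refCell d .simplex ∧ ∑ i, x i = 1}
      (Finset.univ.image fun i : Fin d => {x | x ∈ refCell d .simplex ∧ x i = 0})
  | .cube => (Finset.univ.image fun i : Fin d => {x | x ∈ refCell d .cube ∧ x i = 0}) ∪
      (Finset.univ.image fun i : Fin d => {x | x ∈ refCell d .cube ∧ x i = 1})

/-- An element: a simplex or a parallelepiped, given as an affine image of a reference element. -/
structure Cell (d : ℕ) where
  kind : RefKind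
  map : Vec d ≃ᵃ[ℝ] Vec d

namespace Cell
variable {d : ℕ} (K : Cell d)

/-- The element as a set. -/
def carrier : Set (Vec d) := K.map '' refCell d K.kind

open Classical in
/-- The `(d-1)`-dimensional faces of the element. -/
def facets : Finset (Set (Vec d)) := (refFacets d K.kind).image fun F => K.map '' F

/-- The diameter `h_K`. -/
def h : ℝ := Metric.diam K.carrier

/-- The diameter `ρ_K` of the largest ball inscribed into the element. -/
def rho : ℝ := sSup {s | ∃ (x : Vec d) (r : ℝ), 0 ≤ r ∧ s = 2 * r ∧ Metric.closedBall x r ⊆ K.carrier}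

/-- The function `p ∘ F_K⁻¹` for a polynomial `p` on the reference element. -/
def fn (p : MvPolynomial (Fin d) ℝ) (x : Vec d) : ℝ :=
  MvPolynomial.eval (fun i => K.map.symm x i) p

/-- `n` is the exterior unit normal of the element on its face `F`. -/
def IsNormal (F : Set (Vec d)) (n : Vec d) : Prop :=
  ‖n‖ = 1 ∧ ∀ x ∈ F, ∀ y ∈ K.carrier, ⟪n, y⟫_ℝ ≤ ⟪n, x⟫_ℝ

/-- The exterior unit normal of the element on its `(d-1)`-dimensional face `F`. -/
def normal (F : Set (Vec d)) : Vec d := Classical.epsilon (K.IsNormal F)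

end Cell

/-- `F` is a (nonempty) lower dimensional face of the polytope `K`. -/
def IsProperFace {d : ℕ} (K F : Set (Vec d)) : Prop :=
  F.Nonempty ∧ F ≠ K ∧ IsExposed ℝ K F

/-- The conditions on a partition of `Ω`, given as a finite family of elements. -/
structure IsPartition {d : ℕ} {ι : Type} [Fintype ι] (Ω ΓD : Set (Vec d)) (T : ι → Cell d) :
    Prop where
  cover : closure Ω = ⋃ i, (T i).carrier
  dirichlet : ∃ A : Set (Set (Vec d)), (∀ F ∈ A, ∃ i, F ∈ (T i).facets) ∧ ΓD = ⋃₀ A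
  vertex : ∀ i, ∃ z ∈ (T i).carrier.extremePoints ℝ, z ∈ Ω ∪ (frontier Ω \ ΓD)
  admissible : ∀ i j, i ≠ j → Disjoint (T i).carrier (T j).carrier ∨
    (IsProperFace (T i).carrier ((T i).carrier ∩ (T j).carrier) ∧
      IsProperFace (T j).carrier ((T i).carrier ∩ (T j).carrier))

section Discrete
variable {d : ℕ} {ι : Type} [Fintype ι] (T : ι → Cell d)

/-- The shape parameter `max_K h_K / ρ_K`. -/
def shapeParam : ℝ := ⨆ i, (T i).h / (T i).rho

/-- The union of all elements sharing at least a point with `A`. -/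
def patch (A : Set (Vec d)) : Set (Vec d) :=
  ⋃ (i : ι) (_ : ((T i).carrier ∩ A).Nonempty), (T i).carrier

/-- The two families of local spaces. -/
inductive Family
  | P
  | Q

/-- `p` belongs to the local space of order `k` on the given reference element: total degree at
most `k` on simplices and, for the family `P`, also on cubes; maximal degree at most `k` on cubes
for the family `Q`. -/
def DegreeLE (S : Family) (kind : RefKind) (k : ℕ) (p : MvPolynomial (Fin d) ℝ) : Prop :=
  match S, kind with
  | .Q, .cube => ∀ i, p.degreeOf i ≤ k
  | _, _ => p.totalDegree ≤ k

/-- `S^{k,-1}(T)`: an element is given by its polynomial pieces, the function being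
`(T i).fn (p i)` on the element `T i`. -/
def PiecewisePoly (S : Family) (k : ℕ) : Set (ι → MvPolynomial (Fin d) ℝ) :=
  {p | ∀ i, DegreeLE S (T i).kind k (p i)}

/-- The pieces fit together to a continuous function. -/
def IsContinuous (p : ι → MvPolynomial (Fin d) ℝ) : Prop :=
  ∀ i j, ∀ x ∈ (T i).carrier ∩ (T j).carrier, (T i).fn (p i) x = (T j).fn (p j) x

/-- The function `v` is the piecewise polynomial `p` (almost everywhere on `Ω`). -/
def IsRep (D : Problem d) (p : ι → MvPolynomial (Fin d) ℝ) (v : D.V) : Prop :=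
  ∀ i, (fnOf v) =ᵐ[D.vol (T i).carrier] (T i).fn (p i)

/-- `S_D^{k,0}(T)`: the functions in `H¹_D(Ω)` which are continuous piecewise polynomials. -/
def feSpaceD (D : Problem d) (S : Family) (k : ℕ) : Set D.V :=
  {v | ∃ p ∈ PiecewisePoly T S k, IsContinuous T p ∧ IsRep T D p v}

/-- The streamline diffusion stabilization; `p` are the polynomial pieces of `u_T`. -/
def sdfemTerm (D : Problem d) (ϑ : ι → ℝ) (p : ι → MvPolynomial (Fin d) ℝ) (v : D.V) : ℝ :=
  ∑ i, ϑ i * ∫ x, (-D.ε * Δ ((T i).fn (p i)) x + ⟪D.a x, ∇ ((T i).fn (p i)) x⟫_ℝ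
    + D.b x * (T i).fn (p i) x - D.f x) * ⟪D.a x, gradOf v x⟫_ℝ ∂(D.vol (T i).carrier)

/-- `I` is a quasi-interpolation operator `H¹_D(Ω) → S_D^{1,0}(T)` satisfying the local error
estimates with the constants `c₁, …, c₄`. -/
structure IsQuasiInterpolation (D : Problem d) (S : Family) (I : D.V →ₗ[ℝ] D.V)
    (c₁ c₂ c₃ c₄ : ℝ) : Prop where
  mem : ∀ v, I v ∈ feSpaceD T D S 1
  est₁ : ∀ v i, normL2 (D.vol (T i).carrier) (fnOf (v - I v))
    ≤ c₁ * normL2 (D.vol (patch T (T i).carrier)) (fnOf v)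
  est₂ : ∀ v i, normL2 (D.vol (T i).carrier) (fnOf (v - I v))
    ≤ c₂ * (T i).h * normL2 (D.vol (patch T (T i).carrier)) (gradOf v)
  est₃ : ∀ v i, normL2 (D.vol (T i).carrier) (gradOf (v - I v))
    ≤ c₃ * normL2 (D.vol (patch T (T i).carrier)) (gradOf v)
  est₄ : ∀ v i, ∀ F ∈ (T i).facets, normL2 ((surf d).restrict F) (traceOf F (v - I v))
    ≤ c₄ * √(Metric.diam F) * normL2 (D.vol (patch T F)) (gradOf v)

/-- The inverse estimate holds with the constant `c_I`. -/
def InverseEstimate (D : Problem d) (S : Family) (cI : ℝ) : Prop :=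
  ∀ w ∈ feSpaceD T D S 1, ∀ i, normL2 (D.vol (T i).carrier) (gradOf w)
    ≤ cI * (T i).h⁻¹ * normL2 (D.vol (patch T (T i).carrier)) (fnOf w)

open Classical in
/-- The interior `(d-1)`-dimensional faces of an element. -/
def interiorFacets (D : Problem d) (i : ι) : Finset (Set (Vec d)) :=
  (T i).facets.filter fun F => ¬ F ⊆ frontier D.Ω

open Classical in
/-- The `(d-1)`-dimensional faces of an element on the Neumann boundary. -/
def neumannFacets (D : Problem d) (i : ι) : Finset (Set (Vec d)) :=
  (T i).facets.filter fun F => F ⊆ frontier D.Ω ∧ ¬ F ⊆ D.ΓD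

open Classical in
/-- The jump `𝕁(n_F · ∇u_T)` across an interior face `F`: the sum of the exterior normal
derivatives of the pieces on the two elements sharing `F`. -/
def jump (p : ι → MvPolynomial (Fin d) ℝ) (F : Set (Vec d)) (x : Vec d) : ℝ :=
  ∑ i ∈ Finset.univ.filter (fun i => F ∈ (T i).facets),
    ⟪(T i).normal F, ∇ ((T i).fn (p i)) x⟫_ℝ

/-- Piecewise polynomial approximations `f_T, a_T, b_T ∈ S^{m,-1}(T)` and `g_E ∈ S^{m,-1}(E)` of
the data. -/
structure DataApprox (S : Family) (m : ℕ) where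
  f : ι → MvPolynomial (Fin d) ℝ
  a : Fin d → ι → MvPolynomial (Fin d) ℝ
  b : ι → MvPolynomial (Fin d) ℝ
  /-- the approximation of the Neumann datum, one function for every face -/
  g : Set (Vec d) → Vec d → ℝ
  f_mem : f ∈ PiecewisePoly T S m
  a_mem : ∀ j, a j ∈ PiecewisePoly T S m
  b_mem : b ∈ PiecewisePoly T S m
  g_mem : ∀ i, ∀ F ∈ (T i).facets, ∃ q : MvPolynomial (Fin d) ℝ,
    DegreeLE S (T i).kind m q ∧ ∀ x ∈ F, g F x = (T i).fn q x

variable {T}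

/-- The vector field `a_T` on the element `T i`. -/
def DataApprox.aFn {S : Family} {m : ℕ} (A : DataApprox T S m) (i : ι) (x : Vec d) : Vec d :=
  WithLp.toLp 2 fun j => (T i).fn (A.a j i) x

/-- The residual error indicator `η_K`; `p` are the polynomial pieces of `u_T`. -/
def eta (D : Problem d) {S : Family} {m : ℕ} (A : DataApprox T S m)
    (p : ι → MvPolynomial (Fin d) ℝ) (i : ι) : ℝ :=
  √(D.hbar (T i).carrier ^ 2 * normL2 (D.vol (T i).carrier) (fun x =>
        (T i).fn (A.f i) x + D.ε * Δ ((T i).fn (p i)) x - ⟪A.aFn i x, ∇ ((T i).fn (p i)) x⟫_ℝ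
          - (T i).fn (A.b i) x * (T i).fn (p i) x) ^ 2
    + (1 / 2) * ∑ F ∈ interiorFacets T D i, D.ε ^ (-(1 / 2) : ℝ) * D.hbar F *
        normL2 ((surf d).restrict F) (fun x => D.ε * jump T p F x) ^ 2
    + ∑ F ∈ neumannFacets T D i, D.ε ^ (-(1 / 2) : ℝ) * D.hbar F *
        normL2 ((surf d).restrict F)
          (fun x => A.g F x - D.ε * ⟪(T i).normal F, ∇ ((T i).fn (p i)) x⟫_ℝ) ^ 2)

/-- The data error indicator `θ_K`. -/
def theta (D : Problem d) {S : Family} {m : ℕ} (A : DataApprox T S m)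
    (p : ι → MvPolynomial (Fin d) ℝ) (i : ι) : ℝ :=
  √(D.hbar (T i).carrier ^ 2 * normL2 (D.vol (T i).carrier) (fun x =>
        D.f x - (T i).fn (A.f i) x + ⟪A.aFn i x - D.a x, ∇ ((T i).fn (p i)) x⟫_ℝ
          + ((T i).fn (A.b i) x - D.b x) * (T i).fn (p i) x) ^ 2
    + ∑ F ∈ neumannFacets T D i, D.ε ^ (-(1 / 2) : ℝ) * D.hbar F *
        normL2 ((surf d).restrict F) (fun x => D.g x - A.g F x) ^ 2)

end Discrete

end ConvDiff

end

/-!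
Since `I_T` maps into `S_D^{1,0}(T) ⊆ V(T)`, the discrete equation turns `⟨R, I_T v⟩` into the
stabilization term at `I_T v`. Its contribution from an element `K` is at most
`c_S h_K ‖∇ I_T v‖_K` times the norm of the element residual, and the latter is controlled by
`η_K` and `θ_K` with the weight `ħ_K`. The point is therefore that `h_K ‖∇ I_T v‖_K` is at most a
constant times `ħ_K` times the energy norm of `v` near `K`: stability of `∇ I_T` accounts for the
weight `ε^{-1/2} h_K`, the inverse estimate together with `L²`-stability of `I_T` for the weight
`β^{-1/2}`. Summation over `K` only needs a bound for the number of neighbours of an element: it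
has at most `2^d` vertices, each neighbour contains one of them, and the balls inscribed into the
elements meeting at a point can be packed into a common ball.
-/

namespace ConvDiff

open Classical in
/-- The vertices of the reference elements. -/
noncomputable def refVertices (d : ℕ) : RefKind → Finset (Vec d)
  | .simplex => insert 0 (Finset.univ.image fun i => EuclideanSpace.single i 1)
  | .cube => (Fintype.piFinset fun _ => {0, 1}).image (WithLp.toLp 2)

theorem card_refVertices_le (d : ℕ) (κ : RefKind) : (refVertices d κ).card ≤ 2 ^ d := by
  classical
  cases κ with
  | simplex =>
    calc _ ≤ (Finset.univ.image fun i : Fin d => EuclideanSpace.single i (1 : ℝ)).card + 1 :=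
          Finset.card_insert_le _ _
      _ ≤ d + 1 := by gcongr; exact Finset.card_image_le.trans_eq (Finset.card_fin d)
      _ ≤ 2 ^ d := Nat.lt_two_pow_self
  | cube => exact Finset.card_image_le.trans_eq (by simp)

theorem convex_refCell_simplex (d : ℕ) : Convex ℝ (refCell d .simplex) := by
  intro x hx y hy s t hs ht hst
  refine ⟨fun i => add_nonneg (mul_nonneg hs (hx.1 i)) (mul_nonneg ht (hy.1 i)), ?_⟩
  calc ∑ i, (s • x + t • y) i = s * ∑ i, x i + t * ∑ i, y i := by
        simp only [PiLp.add_apply, PiLp.smul_apply, smul_eq_mul, Finset.sum_add_distrib,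
          Finset.mul_sum]
    _ ≤ s * 1 + t * 1 := by gcongr <;> [exact hx.2; exact hy.2]
    _ = 1 := by rw [mul_one, mul_one, hst]

theorem refCell_simplex_eq_convexHull (d : ℕ) :
    refCell d .simplex = convexHull ℝ (refVertices d .simplex) := by
  classical
  refine Set.Subset.antisymm (fun x hx => ?_) (convexHull_min ?_ (convex_refCell_simplex d))
  · have hrep : x = ∑ o : Option (Fin d), (o.elim (1 - ∑ i, x i) x.ofLp) •
        o.elim 0 fun i => EuclideanSpace.single i 1 := by
      ext j
      simp [Fintype.sum_option, Pi.single_apply]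
    rw [hrep]
    refine (convex_convexHull ℝ _).sum_mem ?_ (by simp [Fintype.sum_option]) ?_
    · rintro (_ | i) _
      exacts [sub_nonneg.2 hx.2, hx.1 i]
    · rintro (_ | i) _ <;> exact subset_convexHull ℝ _ (by simp [refVertices])
  · intro x hx
    obtain rfl | ⟨i, rfl⟩ : x = 0 ∨ ∃ i, EuclideanSpace.single i (1 : ℝ) = x := by
      simpa [refVertices] using hx
    · simp [refCell]
    · refine ⟨fun j => ?_, by simp⟩
      rw [PiLp.single_apply]
      split_ifs <;> simp

theorem refCell_cube_eq_convexHull (d : ℕ) :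
    refCell d .cube = convexHull ℝ (refVertices d .cube) := by
  classical
  have hpi : convexHull ℝ (Set.univ.pi fun _ : Fin d => ({0, 1} : Set ℝ))
      = Set.univ.pi fun _ => Set.Icc 0 1 := by
    simp only [convexHull_pi, convexHull_pair, segment_eq_Icc zero_le_one]
  have himage := (WithLp.linearEquiv 2 ℝ (Fin d → ℝ)).symm.toLinearMap.image_convexHull
    (Set.univ.pi fun _ : Fin d => ({0, 1} : Set ℝ))
  rw [hpi] at himage
  simp only [refVertices, Finset.coe_image, Fintype.coe_piFinset, Finset.coe_pair]
  refine Eq.trans ?_ himage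
  ext x
  exact ⟨fun hx => ⟨x.ofLp, fun i _ => hx i, rfl⟩, by rintro ⟨y, hy, rfl⟩ i; exact hy i trivial⟩

theorem refCell_eq_convexHull (d : ℕ) : ∀ κ, refCell d κ = convexHull ℝ (refVertices d κ)
  | .simplex => refCell_simplex_eq_convexHull d
  | .cube => refCell_cube_eq_convexHull d

theorem refCell_simplex_subset (d : ℕ) : ∀ κ, refCell d .simplex ⊆ refCell d κ
  | .simplex => subset_rfl
  | .cube => fun _ hx i =>
    ⟨hx.1 i, (Finset.single_le_sum (fun j _ => hx.1 j) (Finset.mem_univ i)).trans hx.2⟩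

theorem nonempty_interior_refCell (d : ℕ) (κ : RefKind) : (interior (refCell d κ)).Nonempty := by
  have hopen : IsOpen {x : Vec d | (∀ i, 0 < x i) ∧ ∑ i, x i < 1} := by
    refine IsOpen.and ?_ (isOpen_lt (by fun_prop) continuous_const)
    simp only [Set.ofPred_forall]
    exact isOpen_iInter_of_finite fun i => isOpen_lt continuous_const (by fun_prop)
  refine ⟨WithLp.toLp 2 fun _ => 1 / (d + 1 : ℝ), interior_maximal
    (fun x hx => refCell_simplex_subset d κ ⟨fun i => (hx.1 i).le, hx.2.le⟩) hopen
    ⟨fun _ => Nat.one_div_pos_of_nat, ?_⟩⟩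
  rw [Finset.sum_const, Finset.card_fin, nsmul_eq_mul, mul_one_div, div_lt_one (by positivity)]
  exact lt_add_one _

namespace Cell
variable {d : ℕ} (K : Cell d)

open Classical in
/-- The vertices of the element. -/
noncomputable def vertices : Finset (Vec d) := (refVertices d K.kind).image K.map

theorem card_vertices_le : K.vertices.card ≤ 2 ^ d :=
  Finset.card_image_le.trans (card_refVertices_le d K.kind)

theorem carrier_eq_convexHull : K.carrier = convexHull ℝ K.vertices := by
  rw [carrier, refCell_eq_convexHull, vertices, Finset.coe_image]
  exact AffineMap.image_convexHull (K.map : Vec d →ᵃ[ℝ] Vec d) _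

theorem isCompact_carrier : IsCompact K.carrier :=
  K.carrier_eq_convexHull ▸ K.vertices.finite_toSet.isCompact_convexHull ℝ

theorem convex_carrier : Convex ℝ K.carrier :=
  K.carrier_eq_convexHull ▸ convex_convexHull ℝ _

theorem measurableSet_carrier : MeasurableSet K.carrier :=
  K.isCompact_carrier.measurableSet

theorem extremePoints_carrier_subset : K.carrier.extremePoints ℝ ⊆ K.vertices :=
  K.carrier_eq_convexHull ▸ extremePoints_convexHull_subset

theorem nonempty_interior_carrier : (interior K.carrier).Nonempty := by
  have h : K.map '' interior (refCell d K.kind) = interior K.carrier :=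
    (AffineEquiv.toContinuousAffineEquiv K.map).toHomeomorph.image_interior _
  exact h ▸ (nonempty_interior_refCell d K.kind).image _

theorem two_mul_radius_le_h (hd : 0 < d) {x : Vec d} {r : ℝ} (hr : 0 ≤ r)
    (h : Metric.closedBall x r ⊆ K.carrier) : 2 * r ≤ K.h := by
  have : Nonempty (Fin d) := ⟨⟨0, hd⟩⟩
  calc 2 * r = Metric.diam (Metric.closedBall x r) := (Metric.diam_closedBall_eq x hr).symm
    _ ≤ K.h := Metric.diam_mono h K.isCompact_carrier.isBounded

theorem exists_closedBall_subset :
    ∃ (x : Vec d) (r : ℝ), 0 < r ∧ Metric.closedBall x r ⊆ K.carrier := by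
  obtain ⟨x, hx⟩ := K.nonempty_interior_carrier
  obtain ⟨r, hr, h⟩ := Metric.nhds_basis_closedBall.mem_iff.1 (mem_interior_iff_mem_nhds.1 hx)
  exact ⟨x, r, hr, h⟩

theorem h_pos (hd : 0 < d) : 0 < K.h := by
  obtain ⟨x, r, hr, h⟩ := K.exists_closedBall_subset
  linarith [K.two_mul_radius_le_h hd hr.le h]

theorem rho_nonneg : 0 ≤ K.rho := by
  refine Real.sSup_nonneg ?_
  rintro _ ⟨x, r, hr, rfl, -⟩
  positivity

theorem rho_pos (hd : 0 < d) : 0 < K.rho := by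
  obtain ⟨x, r, hr, h⟩ := K.exists_closedBall_subset
  refine (by positivity : 0 < 2 * r).trans_le (le_csSup ⟨K.h, ?_⟩ ⟨x, r, hr.le, rfl, h⟩)
  rintro _ ⟨y, s, hs, rfl, hK⟩
  exact K.two_mul_radius_le_h hd hs hK

theorem exists_closedBall_subset_rho_lt (hd : 0 < d) :
    ∃ (x : Vec d) (r : ℝ), K.rho < 4 * r ∧ Metric.closedBall x r ⊆ K.carrier := by
  obtain ⟨x, r, hr, h⟩ := K.exists_closedBall_subset
  obtain ⟨_, ⟨y, s, -, rfl, hK⟩, hlt⟩ := exists_lt_of_lt_csSup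
    (s := {s | ∃ (x : Vec d) (r : ℝ), 0 ≤ r ∧ s = 2 * r ∧ Metric.closedBall x r ⊆ K.carrier})
    ⟨2 * r, x, r, hr.le, rfl, h⟩ (half_lt_self (K.rho_pos hd))
  exact ⟨y, s, by linarith [show K.rho / 2 < 2 * s from hlt], hK⟩

end Cell

section ShapeParam
variable {d : ℕ} {ι : Type} (T : ι → Cell d)

theorem shapeParam_nonneg : 0 ≤ shapeParam T :=
  Real.iSup_nonneg fun i => div_nonneg Metric.diam_nonneg (T i).rho_nonneg

theorem h_le_shapeParam_mul_rho [Finite ι] (hd : 0 < d) (i : ι) :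
    (T i).h ≤ shapeParam T * (T i).rho :=
  (div_le_iff₀ ((T i).rho_pos hd)).1
    (le_ciSup (f := fun i => (T i).h / (T i).rho) (Set.finite_range _).bddAbove i)

theorem exists_closedBall_subset_carrier [Finite ι] (hd : 0 < d) (i : ι) :
    ∃ (x : Vec d) (r : ℝ), Metric.closedBall x r ⊆ (T i).carrier ∧
      (T i).h ≤ 4 * shapeParam T * r := by
  obtain ⟨x, r, hr, hK⟩ := (T i).exists_closedBall_subset_rho_lt hd
  refine ⟨x, r, hK, ?_⟩
  nlinarith [h_le_shapeParam_mul_rho T hd i, shapeParam_nonneg T]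

end ShapeParam

section Packing
variable {E : Type*} [NormedAddCommGroup E] [NormedSpace ℝ E] [FiniteDimensional ℝ E]
  [MeasurableSpace E] [BorelSpace E] (μ : Measure E) [μ.IsAddHaarMeasure]

open Module Metric

theorem pow_finrank_mul_measureReal_le {C : Set E} (hC : Convex ℝ C) {z : E} (hz : z ∈ C)
    {h t : ℝ} (hCh : C ⊆ closedBall z h) (ht : 0 ≤ t) (hth : t ≤ h) :
    (t / h) ^ finrank ℝ E * μ.real C ≤ μ.real (C ∩ closedBall z t) := by
  have hc : 0 ≤ t / h := div_nonneg ht (ht.trans hth)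
  have himage : AffineMap.homothety z (t / h) '' C ⊆ C ∩ closedBall z t := by
    rintro _ ⟨y, hy, rfl⟩
    refine ⟨hC.mapsTo_lineMap hz hy ⟨hc, div_le_one_of_le₀ hth (ht.trans hth)⟩, ?_⟩
    rw [mem_closedBall, dist_homothety_center, dist_comm, Real.norm_of_nonneg hc]
    calc t / h * dist y z ≤ t / h * h := by gcongr; exact hCh hy
      _ = t * (h / h) := div_mul_eq_mul_div _ _ _ |>.trans (mul_div_assoc _ _ _)
      _ ≤ t := mul_le_of_le_one_right ht (div_self_le_one h)
  calc (t / h) ^ finrank ℝ E * μ.real C = μ.real (AffineMap.homothety z (t / h) '' C) := by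
        rw [measureReal_def, measureReal_def, Measure.addHaar_image_homothety, ENNReal.toReal_mul,
          abs_of_nonneg (by positivity), ENNReal.toReal_ofReal (by positivity)]
    _ ≤ μ.real (C ∩ closedBall z t) :=
        measureReal_mono himage (measure_ne_top_of_subset Set.inter_subset_right
          measure_closedBall_lt_top.ne)

theorem pow_finrank_mul_measureReal_ball_le {C : Set E} (hC : Convex ℝ C) {x z : E} (hz : z ∈ C)
    {h r t κ : ℝ} (hκ : 0 ≤ κ) (h_pos : 0 < h) (hCh : C ⊆ closedBall z h)
    (hball : closedBall x r ⊆ C) (hr : h ≤ κ * r) (ht : 0 ≤ t) (hth : t ≤ h) :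
    t ^ finrank ℝ E * μ.real (ball 0 1) ≤ κ ^ finrank ℝ E * μ.real (C ∩ closedBall z t) := by
  set n := finrank ℝ E
  have hr_nonneg : 0 ≤ r := (pos_of_mul_pos_right (h_pos.trans_le hr) hκ).le
  calc t ^ n * μ.real (ball 0 1) = (t / h * h) ^ n * μ.real (ball 0 1) := by
        rw [div_mul_cancel₀ _ h_pos.ne']
    _ ≤ (t / h * (κ * r)) ^ n * μ.real (ball 0 1) := by gcongr
    _ = κ ^ n * ((t / h) ^ n * μ.real (closedBall x r)) := by
        rw [Measure.addHaar_real_closedBall μ x hr_nonneg]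
        ring
    _ ≤ κ ^ n * ((t / h) ^ n * μ.real C) := by
        gcongr
        exact measure_ne_top_of_subset hCh measure_closedBall_lt_top.ne
    _ ≤ κ ^ n * μ.real (C ∩ closedBall z t) := by
        gcongr
        exact pow_finrank_mul_measureReal_le μ hC hz hCh ht hth

open scoped Function in
theorem card_le_pow_finrank_of_convex {ι : Type*} {s : Finset ι} {C : ι → Set E} {z : E}
    {x : ι → E} {h r : ι → ℝ} {κ : ℝ} (hκ : 0 ≤ κ)
    (hdisj : (s : Set ι).Pairwise (AEDisjoint μ on C)) (hC : ∀ i ∈ s, Convex ℝ (C i))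
    (hz : ∀ i ∈ s, z ∈ C i) (h_pos : ∀ i ∈ s, 0 < h i) (hCh : ∀ i ∈ s, C i ⊆ closedBall z (h i))
    (hball : ∀ i ∈ s, closedBall (x i) (r i) ⊆ C i) (hr : ∀ i ∈ s, h i ≤ κ * r i) :
    (s.card : ℝ) ≤ κ ^ finrank ℝ E := by
  obtain rfl | hs := s.eq_empty_or_nonempty
  · simpa using pow_nonneg hκ _
  obtain ⟨i₀, hi₀, hmin⟩ := s.exists_min_image h hs
  set t := h i₀
  set n := finrank ℝ E
  have ht : 0 < t := h_pos i₀ hi₀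
  have hball_pos : 0 < μ.real (ball (0 : E) 1) :=
    ENNReal.toReal_pos (measure_ball_pos μ _ one_pos).ne' measure_ball_lt_top.ne
  have hsum : ∑ i ∈ s, μ.real (C i ∩ closedBall z t) ≤ t ^ n * μ.real (ball 0 1) := by
    rw [← Measure.addHaar_real_closedBall μ z ht.le, ← measureReal_biUnion_finset₀
      (fun i hi j hj hij => (hdisj hi hj hij).mono Set.inter_subset_left Set.inter_subset_left)
      (fun i hi => ((hC i hi).inter (convex_closedBall z t)).nullMeasurableSet μ)
      (fun i _ => measure_ne_top_of_subset Set.inter_subset_right measure_closedBall_lt_top.ne)]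
    exact measureReal_mono (Set.iUnion₂_subset fun i _ => Set.inter_subset_right)
      measure_closedBall_lt_top.ne
  refine le_of_mul_le_mul_right ?_ (by positivity : 0 < t ^ n * μ.real (ball (0 : E) 1))
  calc s.card * (t ^ n * μ.real (ball 0 1)) = ∑ _i ∈ s, t ^ n * μ.real (ball 0 1) := by
        rw [Finset.sum_const, nsmul_eq_mul]
    _ ≤ ∑ i ∈ s, κ ^ n * μ.real (C i ∩ closedBall z t) := Finset.sum_le_sum fun i hi =>
        pow_finrank_mul_measureReal_ball_le μ (hC i hi) (hz i hi) hκ (h_pos i hi) (hCh i hi)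
          (hball i hi) (hr i hi) ht.le (hmin i hi)
    _ ≤ κ ^ n * (t ^ n * μ.real (ball 0 1)) := by
        rw [← Finset.mul_sum]
        gcongr

end Packing

theorem IsProperFace.volume_eq_zero {d : ℕ} {K F : Set (Vec d)} (hF : IsProperFace K F) :
    volume F = 0 := by
  obtain ⟨hne, hFK, hexposed⟩ := hF
  obtain ⟨l, rfl⟩ := hexposed hne
  obtain ⟨x, hx, hmax⟩ := hne
  have hl : (l : Vec d →ₗ[ℝ] ℝ) ≠ 0 := by
    intro h
    have hl0 : l = 0 := ContinuousLinearMap.coe_injective h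
    exact hFK (by simp [hl0])
  have hdir : (AffineSubspace.mk' x (LinearMap.ker (l : Vec d →ₗ[ℝ] ℝ))) ≠ ⊤ := by
    intro h
    refine hl (LinearMap.ker_eq_top.1 ?_)
    rw [← AffineSubspace.direction_mk' x (LinearMap.ker _), h, AffineSubspace.direction_top]
  refine measure_mono_null (fun y hy => ?_) (Measure.addHaar_affineSubspace _ _ hdir)
  have : l y = l x := le_antisymm (hmax y hy.1) (hy.2 x hx)
  simp [AffineSubspace.mem_mk', this]

section Neighbours
variable {d : ℕ} {ι : Type} [Fintype ι] {T : ι → Cell d} {Ω ΓD : Set (Vec d)}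

theorem IsPartition.volume_inter (hT : IsPartition Ω ΓD T) {i j : ι} (hij : i ≠ j) :
    volume ((T i).carrier ∩ (T j).carrier) = 0 := by
  rcases hT.admissible i j hij with h | h
  · rw [h.inter_eq, measure_empty]
  · exact h.1.volume_eq_zero

open Classical in
theorem card_filter_mem_carrier_le (hd : 0 < d) (hT : IsPartition Ω ΓD T) (z : Vec d) :
    ((Finset.univ.filter fun i => z ∈ (T i).carrier).card : ℝ) ≤ (4 * shapeParam T) ^ d := by
  choose x r hball hr using exists_closedBall_subset_carrier T hd
  have hκ : 0 ≤ 4 * shapeParam T := mul_nonneg zero_le_four (shapeParam_nonneg T)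
  have h := card_le_pow_finrank_of_convex volume
    (s := Finset.univ.filter fun i => z ∈ (T i).carrier) hκ
    (fun i _ j _ hij => hT.volume_inter hij) (fun i _ => (T i).convex_carrier)
    (fun i hi => (Finset.mem_filter.1 hi).2) (fun i _ => (T i).h_pos hd)
    (fun i hi y hy => Metric.dist_le_diam_of_mem (T i).isCompact_carrier.isBounded hy
      (Finset.mem_filter.1 hi).2) (fun i _ => hball i) (fun i _ => hr i)
  rwa [finrank_euclideanSpace_fin] at h

variable (T) in
open Classical in
/-- The indices of the elements sharing at least a point with the element `T i`. -/
noncomputable def neighbours (i : ι) : Finset ι :=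
  Finset.univ.filter fun j => ((T j).carrier ∩ (T i).carrier).Nonempty

theorem mem_neighbours {i j : ι} :
    j ∈ neighbours T i ↔ ((T j).carrier ∩ (T i).carrier).Nonempty := by
  simp [neighbours]

theorem mem_neighbours_comm {i j : ι} : j ∈ neighbours T i ↔ i ∈ neighbours T j := by
  rw [mem_neighbours, mem_neighbours, Set.inter_comm]

theorem self_mem_neighbours (i : ι) : i ∈ neighbours T i := by
  rw [mem_neighbours, Set.inter_self]
  exact (T i).nonempty_interior_carrier.mono interior_subset

theorem IsPartition.exists_vertex_mem_carrier (hT : IsPartition Ω ΓD T) {i j : ι}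
    (hj : j ∈ neighbours T i) : ∃ z ∈ (T i).vertices, z ∈ (T j).carrier := by
  rw [mem_neighbours, Set.inter_comm] at hj
  suffices ∃ z ∈ (T i).carrier.extremePoints ℝ, z ∈ (T j).carrier from
    this.imp fun z hz => ⟨(T i).extremePoints_carrier_subset hz.1, hz.2⟩
  obtain ⟨z, hz⟩ :=
    ((T i).isCompact_carrier.inter (T j).isCompact_carrier).extremePoints_nonempty hj
  rcases eq_or_ne i j with rfl | hij
  · exact ⟨z, by simpa using hz, hz.1.1⟩
  · have hface := (hT.admissible i j hij).resolve_left (Set.not_disjoint_iff_nonempty_inter.2 hj)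
    exact ⟨z, hface.1.2.2.isExtreme.extremePoints_subset_extremePoints hz, hz.1.2⟩

theorem card_neighbours_le (hd : 0 < d) (hT : IsPartition Ω ΓD T) (i : ι) :
    ((neighbours T i).card : ℝ) ≤ 2 ^ d * (4 * shapeParam T) ^ d := by
  classical
  have hcover : neighbours T i ⊆
      (T i).vertices.biUnion fun z => Finset.univ.filter fun j => z ∈ (T j).carrier := by
    intro j hj
    obtain ⟨z, hz, hzj⟩ := hT.exists_vertex_mem_carrier hj
    exact Finset.mem_biUnion.2 ⟨z, hz, by simpa using hzj⟩
  have := shapeParam_nonneg T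
  calc ((neighbours T i).card : ℝ)
      ≤ ∑ z ∈ (T i).vertices, ((Finset.univ.filter fun j => z ∈ (T j).carrier).card : ℝ) :=
        mod_cast (Finset.card_le_card hcover).trans Finset.card_biUnion_le
    _ ≤ (T i).vertices.card * (4 * shapeParam T) ^ d := by
        rw [← nsmul_eq_mul]
        exact Finset.sum_le_card_nsmul _ _ _ fun z _ => card_filter_mem_carrier_le hd hT z
    _ ≤ 2 ^ d * (4 * shapeParam T) ^ d := by
        gcongr
        exact mod_cast (T i).card_vertices_le

end Neighbours

section Norms
variable {X F : Type*} [MeasurableSpace X] [NormedAddCommGroup F] {μ ν : Measure X} {f g : X → F}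

theorem normL2_nonneg (μ : Measure X) (f : X → F) : 0 ≤ normL2 μ f := ENNReal.toReal_nonneg

theorem normL2_congr_ae (h : f =ᵐ[μ] g) : normL2 μ f = normL2 μ g := by
  rw [normL2, normL2, eLpNorm_congr_ae h]

theorem normL2_add_le (hf : MemLp f 2 μ) (hg : MemLp g 2 μ) :
    normL2 μ (f + g) ≤ normL2 μ f + normL2 μ g := by
  rw [normL2, normL2, normL2, ← ENNReal.toReal_add hf.2.ne hg.2.ne]
  exact ENNReal.toReal_mono (ENNReal.add_ne_top.2 ⟨hf.2.ne, hg.2.ne⟩)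
    (eLpNorm_add_le hf.1 hg.1 one_le_two)

theorem normL2_sub_comm (μ : Measure X) (f g : X → F) : normL2 μ (f - g) = normL2 μ (g - f) :=
  congrArg ENNReal.toReal (eLpNorm_sub_comm f g 2 μ)

theorem normL2_mono_measure (hf : MemLp f 2 ν) (h : μ ≤ ν) : normL2 μ f ≤ normL2 ν f :=
  ENNReal.toReal_mono hf.2.ne (eLpNorm_mono_measure f h)

theorem normL2_le_one_add_mul (hf : MemLp f 2 ν) (hg : MemLp g 2 ν) (hμν : μ ≤ ν) {c : ℝ}
    (h : normL2 μ (f - g) ≤ c * normL2 ν f) : normL2 μ g ≤ (1 + c) * normL2 ν f := by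
  have hf' := hf.mono_measure hμν
  have hg' := hg.mono_measure hμν
  calc normL2 μ g = normL2 μ (f + (g - f)) := by rw [add_sub_cancel]
    _ ≤ normL2 μ f + normL2 μ (g - f) := normL2_add_le hf' (hg'.sub hf')
    _ ≤ normL2 ν f + c * normL2 ν f :=
        add_le_add (normL2_mono_measure hf hμν) (normL2_sub_comm μ f g ▸ h)
    _ = (1 + c) * normL2 ν f := by ring

theorem lintegral_enorm_sq (μ : Measure X) (f : X → F) :
    ∫⁻ x, ‖f x‖ₑ ^ 2 ∂μ = eLpNorm f 2 μ ^ 2 := by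
  simpa using (eLpNorm_nnreal_pow_eq_lintegral (f := f) (μ := μ) (p := 2) two_ne_zero).symm

theorem normL2_sq (μ : Measure X) (f : X → F) :
    normL2 μ f ^ 2 = (∫⁻ x, ‖f x‖ₑ ^ 2 ∂μ).toReal := by
  rw [lintegral_enorm_sq, ENNReal.toReal_pow, normL2]

theorem lintegral_enorm_sq_ne_top (hf : MemLp f 2 μ) : ∫⁻ x, ‖f x‖ₑ ^ 2 ∂μ ≠ ⊤ :=
  lintegral_enorm_sq μ f ▸ ENNReal.pow_ne_top hf.2.ne

theorem normL2_sq_biUnion_le {ι : Type*} (s : Finset ι) (A : ι → Set X) (hf : MemLp f 2 μ) :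
    normL2 (μ.restrict (⋃ i ∈ s, A i)) f ^ 2 ≤ ∑ i ∈ s, normL2 (μ.restrict (A i)) f ^ 2 := by
  have hfin : ∀ i ∈ s, ∫⁻ x in A i, ‖f x‖ₑ ^ 2 ∂μ ≠ ⊤ := fun i _ =>
    lintegral_enorm_sq_ne_top (hf.restrict _)
  simp only [normL2_sq]
  rw [← ENNReal.toReal_sum hfin]
  refine ENNReal.toReal_mono (ENNReal.sum_ne_top.2 hfin) ?_
  have hunion : ⋃ i ∈ s, A i = ⋃ i : s, A i := Set.biUnion_eq_iUnion (s : Set ι) fun i _ => A i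
  rw [hunion, ← Finset.sum_coe_sort s, ← tsum_fintype (L := .unconditional _)]
  exact lintegral_iUnion_le (fun i : s => A i) _

theorem sum_normL2_sq_le {ι : Type*} [Fintype ι] {A : ι → Set X} (hf : MemLp f 2 μ)
    (hA : ∀ i, MeasurableSet (A i)) (hdisj : ∀ i j, i ≠ j → μ (A i ∩ A j) = 0) :
    ∑ i, normL2 (μ.restrict (A i)) f ^ 2 ≤ normL2 μ f ^ 2 := by
  simp only [normL2_sq]
  rw [← ENNReal.toReal_sum fun i _ => lintegral_enorm_sq_ne_top (hf.restrict _),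
    ← lintegral_biUnion_finset₀ (fun i _ j _ => hdisj i j) fun i _ => (hA i).nullMeasurableSet]
  exact ENNReal.toReal_mono (lintegral_enorm_sq_ne_top hf) (setLIntegral_le_lintegral _ _)

theorem abs_integral_mul_le {f g : X → ℝ} (hf : MemLp f 2 μ) (hg : MemLp g 2 μ) :
    |∫ x, f x * g x ∂μ| ≤ normL2 μ f * normL2 μ g := by
  rw [normL2, normL2, ← ENNReal.toReal_mul, ← Real.norm_eq_abs, ← toReal_enorm]
  refine ENNReal.toReal_mono (ENNReal.mul_ne_top hf.2.ne hg.2.ne) ?_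
  calc ‖∫ x, f x * g x ∂μ‖ₑ ≤ ∫⁻ x, ‖f x * g x‖ₑ ∂μ := enorm_integral_le_lintegral_enorm _
    _ = eLpNorm (fun x => f x * g x) 1 μ := eLpNorm_one_eq_lintegral_enorm.symm
    _ ≤ eLpNorm f 2 μ * eLpNorm g 2 μ := by
        simpa using eLpNorm_le_eLpNorm_mul_eLpNorm_of_nnnorm (p := 2) (q := 2) (r := 1) hf.1 hg.1
          (· * ·) 1 (Eventually.of_forall fun x => by simp)

section Inner
variable [InnerProductSpace ℝ F]

theorem eLpNorm_inner_le (f : X → F) (hg : AEStronglyMeasurable g μ) :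
    eLpNorm (fun x => ⟪f x, g x⟫_ℝ) 2 μ ≤ eLpNorm f ⊤ μ * eLpNorm g 2 μ := by
  simpa using eLpNorm_le_eLpNorm_top_mul_eLpNorm 2 f hg (fun u v => ⟪u, v⟫_ℝ) 1
    (Eventually.of_forall fun x => (one_mul ‖f x‖₊).symm ▸ nnnorm_inner_le_nnnorm (f x) (g x))

theorem memLp_inner (hf : MemLp f ⊤ μ) (hg : MemLp g 2 μ) :
    MemLp (fun x => ⟪f x, g x⟫_ℝ) 2 μ :=
  ⟨hf.1.inner hg.1, (eLpNorm_inner_le f hg.1).trans_lt (ENNReal.mul_lt_top hf.2 hg.2)⟩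

theorem normL2_inner_le (hf : MemLp f ⊤ μ) (hg : MemLp g 2 μ) :
    normL2 μ (fun x => ⟪f x, g x⟫_ℝ) ≤ normLinf μ f * normL2 μ g := by
  rw [normLinf, normL2, normL2, ← ENNReal.toReal_mul]
  exact ENNReal.toReal_mono (ENNReal.mul_ne_top hf.2.ne hg.2.ne) (eLpNorm_inner_le f hg.1)

end Inner

end Norms

namespace Problem
variable {d : ℕ} (D : Problem d)

theorem vol_le (A : Set (Vec d)) : D.vol A ≤ volume.restrict D.Ω := Measure.restrict_le_self

theorem memLp_fnOf (v : D.V) : MemLp (fnOf v) 2 (volume.restrict D.Ω) := Lp.memLp v.1.1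

theorem memLp_gradOf (v : D.V) : MemLp (gradOf v) 2 (volume.restrict D.Ω) := Lp.memLp v.1.2

theorem fnOf_sub_ae (v w : D.V) : fnOf (v - w) =ᵐ[volume.restrict D.Ω] fnOf v - fnOf w :=
  Lp.coeFn_sub v.1.1 w.1.1

theorem gradOf_sub_ae (v w : D.V) :
    gradOf (v - w) =ᵐ[volume.restrict D.Ω] gradOf v - gradOf w :=
  Lp.coeFn_sub v.1.2 w.1.2

theorem memLp_of_continuous {F : Type*} [NormedAddCommGroup F] [SecondCountableTopology F]
    {f : Vec d → F} (hf : Continuous f) (q : ℝ≥0∞) (A : Set (Vec d)) : MemLp f q (D.vol A) := by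
  have : IsFiniteMeasure (volume.restrict D.Ω) :=
    ⟨(Measure.restrict_apply_univ D.Ω).trans_lt D.isBounded_Ω.measure_lt_top⟩
  obtain ⟨C, hC⟩ := D.isBounded_Ω.isCompact_closure.exists_bound_of_continuousOn hf.continuousOn
  refine MemLp.mono_measure (D.vol_le A) (MemLp.of_bound hf.aestronglyMeasurable C ?_)
  filter_upwards [ae_restrict_mem D.isOpen_Ω.measurableSet] with x hx
  exact hC x (subset_closure hx)

/-- The squared energy norm of `v` on `A`. -/
noncomputable def energy (v : D.V) (A : Set (Vec d)) : ℝ :=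
  D.ε * normL2 (D.vol A) (gradOf v) ^ 2 + D.β * normL2 (D.vol A) (fnOf v) ^ 2

theorem mul_normL2_gradOf_sq_le_energy (v : D.V) (A : Set (Vec d)) :
    D.ε * normL2 (D.vol A) (gradOf v) ^ 2 ≤ D.energy v A :=
  le_add_of_nonneg_right (mul_nonneg D.β_nonneg (sq_nonneg _))

theorem mul_normL2_fnOf_sq_le_energy (v : D.V) (A : Set (Vec d)) :
    D.β * normL2 (D.vol A) (fnOf v) ^ 2 ≤ D.energy v A :=
  le_add_of_nonneg_left (mul_nonneg D.ε_pos.le (sq_nonneg _))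

theorem energy_nonneg (v : D.V) (A : Set (Vec d)) : 0 ≤ D.energy v A :=
  (mul_nonneg D.ε_pos.le (sq_nonneg _)).trans (D.mul_normL2_gradOf_sq_le_energy v A)

theorem normE_nonneg (v : D.V) : 0 ≤ D.normE v := Real.sqrt_nonneg _

theorem hbar_nonneg (A : Set (Vec d)) : 0 ≤ D.hbar A := by
  have := D.ε_pos.le
  have := D.β_nonneg
  have : 0 ≤ Metric.diam A := Metric.diam_nonneg
  unfold hbar
  split_ifs <;> positivity

theorem le_mul_hbar {A : Set (Vec d)} {x y : ℝ} (hy : 0 ≤ y)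
    (hε : x ≤ y * (D.ε ^ (-(1 / 2) : ℝ) * Metric.diam A))
    (hβ : 0 < D.β → x ≤ y * D.β ^ (-(1 / 2) : ℝ)) : x ≤ y * D.hbar A := by
  unfold hbar
  split_ifs with h
  · exact (le_min hε (hβ h)).trans_eq (mul_min_of_nonneg _ _ hy).symm
  · exact hε

end Problem

section EnergyOverlap
variable {d : ℕ} {ι : Type} {T : ι → Cell d} {D : Problem d}

theorem vol_carrier_le_patch (i : ι) : D.vol (T i).carrier ≤ D.vol (patch T (T i).carrier) :=
  Measure.restrict_mono (Set.subset_iUnion₂_of_subset i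
    (by simpa using (T i).nonempty_interior_carrier.mono interior_subset) subset_rfl) le_rfl

variable [Fintype ι]

theorem patch_carrier_eq (i : ι) :
    patch T (T i).carrier = ⋃ j ∈ neighbours T i, (T j).carrier := by
  simp only [patch, mem_neighbours]

theorem normL2_sq_patch_le {F : Type*} [NormedAddCommGroup F] {f : Vec d → F}
    (hf : MemLp f 2 (volume.restrict D.Ω)) (i : ι) :
    normL2 (D.vol (patch T (T i).carrier)) f ^ 2
      ≤ ∑ j ∈ neighbours T i, normL2 (D.vol (T j).carrier) f ^ 2 :=
  patch_carrier_eq (T := T) i ▸ normL2_sq_biUnion_le _ _ hf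

theorem energy_patch_le (v : D.V) (i : ι) :
    D.energy v (patch T (T i).carrier) ≤ ∑ j ∈ neighbours T i, D.energy v (T j).carrier := by
  simp only [Problem.energy, Finset.sum_add_distrib, ← Finset.mul_sum]
  have := D.ε_pos.le
  have := D.β_nonneg
  gcongr
  · exact normL2_sq_patch_le (D.memLp_gradOf v) i
  · exact normL2_sq_patch_le (D.memLp_fnOf v) i

theorem sum_energy_le (hT : IsPartition D.Ω D.ΓD T) (v : D.V) :
    ∑ i, D.energy v (T i).carrier ≤ D.normE v ^ 2 := by
  have hε := D.ε_pos.le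
  have hβ := D.β_nonneg
  have hmeas : ∀ i, MeasurableSet (T i).carrier := fun i => (T i).measurableSet_carrier
  have hdisj : ∀ i j, i ≠ j → volume.restrict D.Ω ((T i).carrier ∩ (T j).carrier) = 0 :=
    fun i j hij => Measure.absolutelyContinuous_of_le Measure.restrict_le_self (hT.volume_inter hij)
  rw [Problem.normE, Real.sq_sqrt (by positivity)]
  simp only [Problem.energy, Finset.sum_add_distrib, ← Finset.mul_sum]
  gcongr
  · exact sum_normL2_sq_le (D.memLp_gradOf v) hmeas hdisj
  · exact sum_normL2_sq_le (D.memLp_fnOf v) hmeas hdisj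

theorem sum_sum_neighbours_le {N : ℝ} (hN : ∀ i, ((neighbours T i).card : ℝ) ≤ N) {x : ι → ℝ}
    (hx : ∀ i, 0 ≤ x i) : ∑ i, ∑ j ∈ neighbours T i, x j ≤ N * ∑ j, x j := by
  rw [Finset.sum_comm' (t' := Finset.univ) (s' := neighbours T)
    (fun i j => by simp [mem_neighbours_comm (i := i) (j := j)]), Finset.mul_sum]
  refine Finset.sum_le_sum fun j _ => ?_
  rw [Finset.sum_const, nsmul_eq_mul]
  exact mul_le_mul_of_nonneg_right (hN j) (hx j)

variable (T) in
/-- The squared energy norm of `v` on the second order neighbourhood of the element `T i`. An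
element counts as often as it is a neighbour of a neighbour of `T i`. -/
noncomputable def energyNear (v : D.V) (i : ι) : ℝ :=
  ∑ j ∈ neighbours T i, ∑ m ∈ neighbours T j, D.energy v (T m).carrier

theorem sum_neighbours_energy_le_energyNear (v : D.V) (i : ι) :
    ∑ j ∈ neighbours T i, D.energy v (T j).carrier ≤ energyNear T v i :=
  Finset.sum_le_sum fun j _ => Finset.single_le_sum
    (f := fun m => D.energy v (T m).carrier) (fun _ _ => D.energy_nonneg _ _)
    (self_mem_neighbours j)

theorem energyNear_nonneg (v : D.V) (i : ι) : 0 ≤ energyNear T v i :=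
  Finset.sum_nonneg fun _ _ => Finset.sum_nonneg fun _ _ => D.energy_nonneg _ _

theorem sum_energyNear_le (hd : 0 < d) (hT : IsPartition D.Ω D.ΓD T) (v : D.V) :
    ∑ i, energyNear T v i ≤ (2 ^ d * (4 * shapeParam T) ^ d * D.normE v) ^ 2 := by
  set N := 2 ^ d * (4 * shapeParam T) ^ d
  have hN : 0 ≤ N := by
    have := shapeParam_nonneg T
    positivity
  have hcard : ∀ i, ((neighbours T i).card : ℝ) ≤ N := card_neighbours_le hd hT
  have henergy := fun i => D.energy_nonneg v (T i).carrier
  calc ∑ i, energyNear T v i ≤ N * ∑ j, ∑ m ∈ neighbours T j, D.energy v (T m).carrier :=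
        sum_sum_neighbours_le hcard fun j => Finset.sum_nonneg fun m _ => henergy m
    _ ≤ N * (N * D.normE v ^ 2) := by
        gcongr
        exact (sum_sum_neighbours_le hcard henergy).trans (by gcongr; exact sum_energy_le hT v)
    _ = (N * D.normE v) ^ 2 := by ring

end EnergyOverlap

section LocalStability
variable {d : ℕ} {ι : Type} {T : ι → Cell d} {D : Problem d} {S : Family} {I : D.V → D.V}
  {s₀ s₁ : ℝ}

/-- Local stability of an operator `H¹_D(Ω) → S_D^{1,0}(T)` in `L²` and in the `H¹`-seminorm, from
the patch of an element to the element, with the constants `s₀` and `s₁`. The operator need not be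
linear. -/
structure IsLocallyStable (T : ι → Cell d) (D : Problem d) (S : Family) (I : D.V → D.V)
    (s₀ s₁ : ℝ) : Prop where
  mem : ∀ v, I v ∈ feSpaceD T D S 1
  normL2_fnOf_le : ∀ v i, normL2 (D.vol (T i).carrier) (fnOf (I v))
    ≤ s₀ * normL2 (D.vol (patch T (T i).carrier)) (fnOf v)
  normL2_gradOf_le : ∀ v i, normL2 (D.vol (T i).carrier) (gradOf (I v))
    ≤ s₁ * normL2 (D.vol (patch T (T i).carrier)) (gradOf v)

theorem IsQuasiInterpolation.isLocallyStable {I : D.V →ₗ[ℝ] D.V} {c₁ c₂ c₃ c₄ : ℝ}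
    (hI : IsQuasiInterpolation T D S I c₁ c₂ c₃ c₄) :
    IsLocallyStable T D S I (1 + c₁) (1 + c₃) where
  mem := hI.mem
  normL2_fnOf_le v i := normL2_le_one_add_mul ((D.memLp_fnOf v).restrict _)
    ((D.memLp_fnOf (I v)).restrict _) (vol_carrier_le_patch i)
    (normL2_congr_ae (ae_restrict_of_ae (D.fnOf_sub_ae v (I v))) ▸ hI.est₁ v i)
  normL2_gradOf_le v i := normL2_le_one_add_mul ((D.memLp_gradOf v).restrict _)
    ((D.memLp_gradOf (I v)).restrict _) (vol_carrier_le_patch i)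
    (normL2_congr_ae (ae_restrict_of_ae (D.gradOf_sub_ae v (I v))) ▸ hI.est₃ v i)

theorem le_rpow_neg_half_mul_sqrt {e x G : ℝ} (he : 0 < e) (hx : e * x ^ 2 ≤ G) :
    x ≤ e ^ (-(1 / 2) : ℝ) * √G := by
  rw [Real.rpow_neg he.le, ← Real.sqrt_eq_rpow, inv_mul_eq_div, le_div_iff₀ (Real.sqrt_pos.2 he)]
  refine Real.le_sqrt_of_sq_le ?_
  rwa [mul_pow, Real.sq_sqrt he.le, mul_comm]

variable [Fintype ι]

theorem normL2_gradOf_patch_le (v : D.V) (i : ι) :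
    normL2 (D.vol (patch T (T i).carrier)) (gradOf v)
      ≤ D.ε ^ (-(1 / 2) : ℝ) * √(energyNear T v i) :=
  le_rpow_neg_half_mul_sqrt D.ε_pos <| (D.mul_normL2_gradOf_sq_le_energy v _).trans <|
    (energy_patch_le v i).trans (sum_neighbours_energy_le_energyNear v i)

namespace IsLocallyStable
variable (hI : IsLocallyStable T D S I s₀ s₁)
include hI

theorem mul_normL2_fnOf_patch_sq_le (v : D.V) (i : ι) :
    D.β * normL2 (D.vol (patch T (T i).carrier)) (fnOf (I v)) ^ 2
      ≤ s₀ ^ 2 * energyNear T v i := by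
  have hβ := D.β_nonneg
  calc D.β * normL2 (D.vol (patch T (T i).carrier)) (fnOf (I v)) ^ 2
      ≤ D.β * ∑ j ∈ neighbours T i, normL2 (D.vol (T j).carrier) (fnOf (I v)) ^ 2 := by
        gcongr
        exact normL2_sq_patch_le (D.memLp_fnOf (I v)) i
    _ ≤ D.β * ∑ j ∈ neighbours T i,
          (s₀ * normL2 (D.vol (patch T (T j).carrier)) (fnOf v)) ^ 2 := by
        gcongr with j
        · exact normL2_nonneg _ _
        · exact hI.normL2_fnOf_le v j
    _ = s₀ ^ 2 * ∑ j ∈ neighbours T i,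
          D.β * normL2 (D.vol (patch T (T j).carrier)) (fnOf v) ^ 2 := by
        simp only [mul_pow, ← Finset.mul_sum]
        ring
    _ ≤ s₀ ^ 2 * energyNear T v i := by
        unfold energyNear
        gcongr with j
        exact (D.mul_normL2_fnOf_sq_le_energy v _).trans (energy_patch_le v j)

theorem normL2_fnOf_patch_le (hβ : 0 < D.β) (v : D.V) (i : ι) :
    normL2 (D.vol (patch T (T i).carrier)) (fnOf (I v))
      ≤ |s₀| * (D.β ^ (-(1 / 2) : ℝ) * √(energyNear T v i)) := by
  refine (le_rpow_neg_half_mul_sqrt hβ (hI.mul_normL2_fnOf_patch_sq_le v i)).trans_eq ?_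
  rw [Real.sqrt_mul (sq_nonneg _), Real.sqrt_sq_eq_abs]
  ring

-- The gradient stability covers the `ε`-part of `ħ`, the inverse estimate and the `L²`-stability
-- cover the `β`-part.
theorem h_mul_normL2_gradOf_le (hd : 0 < d) {cI : ℝ} (hinv : InverseEstimate T D S cI) (v : D.V)
    (i : ι) : (T i).h * normL2 (D.vol (T i).carrier) (gradOf (I v))
      ≤ max s₁ |cI * s₀| * √(energyNear T v i) * D.hbar (T i).carrier := by
  have hh := (T i).h_pos hd
  have : 0 ≤ max s₁ |cI * s₀| := le_max_of_le_right (abs_nonneg _)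
  refine D.le_mul_hbar (by positivity) ?_ fun hβ => ?_
  · calc (T i).h * normL2 (D.vol (T i).carrier) (gradOf (I v))
        ≤ (T i).h * (s₁ * normL2 (D.vol (patch T (T i).carrier)) (gradOf v)) := by
          gcongr
          exact hI.normL2_gradOf_le v i
      _ ≤ (T i).h * (max s₁ |cI * s₀| * (D.ε ^ (-(1 / 2) : ℝ) * √(energyNear T v i))) := by
          gcongr
          · exact normL2_nonneg _ _
          · exact le_max_left _ _
          · exact normL2_gradOf_patch_le v i
      _ = max s₁ |cI * s₀| * √(energyNear T v i) * (D.ε ^ (-(1 / 2) : ℝ) * (T i).h) := by ring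
  · calc (T i).h * normL2 (D.vol (T i).carrier) (gradOf (I v))
        ≤ (T i).h * (cI * (T i).h⁻¹ * normL2 (D.vol (patch T (T i).carrier)) (fnOf (I v))) := by
          gcongr
          exact hinv (I v) (hI.mem v) i
      _ = cI * normL2 (D.vol (patch T (T i).carrier)) (fnOf (I v)) := by field_simp
      _ ≤ |cI| * (|s₀| * (D.β ^ (-(1 / 2) : ℝ) * √(energyNear T v i))) := by
          gcongr
          · exact normL2_nonneg _ _
          · exact le_abs_self cI
          · exact hI.normL2_fnOf_patch_le hβ v i
      _ = |cI * s₀| * √(energyNear T v i) * D.β ^ (-(1 / 2) : ℝ) := by rw [abs_mul]; ring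
      _ ≤ max s₁ |cI * s₀| * √(energyNear T v i) * D.β ^ (-(1 / 2) : ℝ) := by
          have := Real.rpow_nonneg D.β_nonneg (-(1 / 2))
          gcongr
          exact le_max_right _ _

end IsLocallyStable

end LocalStability

section WeakGradient
variable {d : ℕ} {Ω U : Set (Vec d)} {u u' ψ : Vec d → ℝ} {g g' : Vec d → Vec d}

theorem setIntegral_smul_eq_of_tsupport_subset {F : Type*} [NormedAddCommGroup F]
    [NormedSpace ℝ F] {φ : Vec d → ℝ} (hφ : tsupport φ ⊆ U) (f : Vec d → F) :
    ∫ x in U, φ x • f x = ∫ x, φ x • f x :=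
  setIntegral_eq_integral_of_forall_compl_eq_zero fun x hx => by
    rw [image_eq_zero_of_notMem_tsupport (f := φ) fun hx' => hx (hφ hx'), zero_smul]

theorem integrable_smul_of_tsupport_subset {F : Type*} [NormedAddCommGroup F] [NormedSpace ℝ F]
    {f : Vec d → F} (hf : LocallyIntegrableOn f U) {φ : Vec d → ℝ} (hφ : Continuous φ)
    (hc : HasCompactSupport φ) (hφU : tsupport φ ⊆ U) : Integrable fun x => φ x • f x :=
  (integrableOn_iff_integrable_of_support_subset
    ((Function.support_smul_subset_left φ f).trans (subset_tsupport φ))).1 <|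
    (hf.integrableOn_compact_subset hφU hc).continuousOn_smul hφ.continuousOn hc

theorem HasWeakGradient.mono (h : HasWeakGradient Ω u g) (hU : U ⊆ Ω) :
    HasWeakGradient U u g := by
  intro φ hφ hc hφU w
  have key := h φ hφ hc (hφU.trans hU) w
  have hdφU : tsupport (fun x => fderiv ℝ φ x w) ⊆ U :=
    (tsupport_fderiv_apply_subset ℝ w).trans hφU
  simp only [mul_comm _ (φ _), mul_comm _ (fderiv ℝ φ _ w), ← smul_eq_mul] at key ⊢
  rwa [setIntegral_smul_eq_of_tsupport_subset hdφU, setIntegral_smul_eq_of_tsupport_subset hφU,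
    ← setIntegral_smul_eq_of_tsupport_subset (hdφU.trans hU),
    ← setIntegral_smul_eq_of_tsupport_subset (hφU.trans hU)]

theorem HasWeakGradient.congr_ae (h : HasWeakGradient U u g) (hu : u =ᵐ[volume.restrict U] u') :
    HasWeakGradient U u' g := fun φ hφ hc hφU w =>
  (integral_congr_ae (hu.mono fun x hx => by simp only [hx])).symm.trans (h φ hφ hc hφU w)

theorem hasWeakGradient_gradient (hψ : ContDiff ℝ ∞ ψ) : HasWeakGradient U ψ (∇ ψ) := by
  refine HasWeakGradient.mono (Ω := Set.univ) ?_ U.subset_univ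
  intro φ hφ hc _ w
  have hdψ : Continuous fun x => fderiv ℝ ψ x w := by
    have := hψ.continuous_fderiv (by simp)
    fun_prop
  have hdφ : Continuous fun x => fderiv ℝ φ x w := by
    have := hφ.continuous_fderiv (by simp)
    fun_prop
  have hcdφ : HasCompactSupport fun x => fderiv ℝ φ x w := hc.fderiv_apply ℝ w
  simp only [Measure.restrict_univ, inner_gradient_left]
  exact integral_mul_fderiv_eq_neg_fderiv_mul_of_integrable
    ((hdψ.mul hφ.continuous).integrable_of_hasCompactSupport hc.mul_left)
    ((hψ.continuous.mul hdφ).integrable_of_hasCompactSupport hcdφ.mul_left)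
    ((hψ.continuous.mul hφ.continuous).integrable_of_hasCompactSupport hc.mul_left)
    (fun x _ => hψ.differentiable (by simp) x) fun x _ => hφ.differentiable (by simp) x

theorem HasWeakGradient.ae_eq (hU : IsOpen U) (hg : LocallyIntegrableOn g U)
    (hg' : LocallyIntegrableOn g' U) (h : HasWeakGradient U u g) (h' : HasWeakGradient U u g') :
    g =ᵐ[volume.restrict U] g' := by
  have hzero : ∀ᵐ x, x ∈ U → (g - g') x = 0 := by
    refine hU.ae_eq_zero_of_integral_contDiff_smul_eq_zero (hg.sub hg') fun φ hφ hc hφU => ?_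
    have hφg := integrable_smul_of_tsupport_subset hg hφ.continuous hc hφU
    have hφg' := integrable_smul_of_tsupport_subset hg' hφ.continuous hc hφU
    simp only [Pi.sub_apply, smul_sub]
    rw [integral_sub hφg hφg', sub_eq_zero, ← setIntegral_smul_eq_of_tsupport_subset hφU,
      ← setIntegral_smul_eq_of_tsupport_subset hφU]
    refine ext_inner_left ℝ fun w => ?_
    rw [← integral_inner hφg.integrableOn, ← integral_inner hφg'.integrableOn]
    have := neg_injective ((h φ hφ hc hφU w).symm.trans (h' φ hφ hc hφU w))
    simpa only [real_inner_smul_right, real_inner_comm w, mul_comm (φ _)] using this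
  filter_upwards [(ae_restrict_iff' hU.measurableSet).2 hzero] with x hx
  exact sub_eq_zero.1 hx

end WeakGradient

section ElementGradient
variable {d : ℕ} {D : Problem d}

theorem gradOf_ae_eq_gradient {U : Set (Vec d)} (hU : IsOpen U) (hUΩ : U ⊆ D.Ω) (v : D.V)
    {ψ : Vec d → ℝ} (hψ : ContDiff ℝ ∞ ψ) (h : fnOf v =ᵐ[volume.restrict U] ψ) :
    gradOf v =ᵐ[volume.restrict U] ∇ ψ := by
  have hv : HasWeakGradient D.Ω (fnOf v) (gradOf v) := v.2.1
  have hgrad : LocallyIntegrableOn (gradOf v) U :=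
    (locallyIntegrableOn_of_locallyIntegrable_restrict
      ((D.memLp_gradOf v).locallyIntegrable one_le_two)).mono_set hUΩ
  exact ((hv.mono hUΩ).congr_ae h).ae_eq hU hgrad
    ((continuous_gradient hψ).locallyIntegrable.locallyIntegrableOn U)
    (hasWeakGradient_gradient hψ)

/-- The part of `Ω` in the interior of an element. -/
def openPart (D : Problem d) (K : Cell d) : Set (Vec d) := D.Ω ∩ interior K.carrier

theorem isOpen_openPart (K : Cell d) : IsOpen (openPart D K) := D.isOpen_Ω.inter isOpen_interior

theorem vol_eq_restrict_openPart (K : Cell d) :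
    D.vol K.carrier = volume.restrict (openPart D K) := by
  rw [Problem.vol, Measure.restrict_restrict K.measurableSet_carrier, Set.inter_comm]
  exact Measure.restrict_congr_set <| (ae_eq_refl D.Ω).inter
    (interior_ae_eq_of_null_frontier (K.convex_carrier.addHaar_frontier volume)).symm

namespace Cell
variable (K : Cell d) (p q : MvPolynomial (Fin d) ℝ)

theorem fn_add : K.fn (p + q) = K.fn p + K.fn q := by ext x; simp [fn]

theorem fn_smul (c : ℝ) : K.fn (c • p) = c • K.fn p := by ext x; simp [fn]

theorem contDiff_fn : ContDiff ℝ ∞ (K.fn p) := by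
  have hmap : ContDiff ℝ ∞ K.map.symm :=
    (K.map.symm.toContinuousAffineEquiv : Vec d →ᴬ[ℝ] Vec d).contDiff
  induction p using MvPolynomial.induction_on with
  | C c =>
    have : K.fn (MvPolynomial.C c) = fun _ => c := by ext x; simp [fn]
    exact this ▸ contDiff_const
  | add p q hp hq => exact K.fn_add p q ▸ hp.add hq
  | mul_X p i hp =>
    have : K.fn (p * MvPolynomial.X i) = fun x => K.fn p x * K.map.symm x i := by
      ext x; simp [fn]
    exact this ▸ hp.mul (contDiff_euclidean.1 hmap i)

theorem continuous_fn : Continuous (K.fn p) := (K.contDiff_fn p).continuous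

theorem differentiable_fn : Differentiable ℝ (K.fn p) := (K.contDiff_fn p).differentiable (by simp)

theorem continuous_gradient_fn : Continuous (∇ (K.fn p)) := continuous_gradient (K.contDiff_fn p)

theorem gradient_fn_add : ∇ (K.fn (p + q)) = ∇ (K.fn p) + ∇ (K.fn q) := by
  ext1 x
  simp only [gradient, Pi.add_apply, fn_add,
    fderiv_add (K.differentiable_fn p x) (K.differentiable_fn q x), map_add]

theorem gradient_fn_smul (c : ℝ) : ∇ (K.fn (c • p)) = c • ∇ (K.fn p) := by
  ext1 x
  simp only [gradient, Pi.smul_apply, fn_smul, fderiv_const_smul (K.differentiable_fn p x),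
    map_smul]

end Cell

variable {K : Cell d} {p : MvPolynomial (Fin d) ℝ}

theorem gradOf_ae_eq_gradient_fn {v : D.V} (h : fnOf v =ᵐ[D.vol K.carrier] K.fn p) :
    gradOf v =ᵐ[D.vol K.carrier] ∇ (K.fn p) := by
  rw [vol_eq_restrict_openPart] at h ⊢
  exact gradOf_ae_eq_gradient (isOpen_openPart K) Set.inter_subset_left v (K.contDiff_fn p) h

theorem gradient_fn_ae_eq_zero (h : K.fn p =ᵐ[D.vol K.carrier] 0) :
    ∇ (K.fn p) =ᵐ[D.vol K.carrier] 0 := by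
  rw [vol_eq_restrict_openPart] at h ⊢
  have hU := isOpen_openPart (D := D) K
  have hzero : Set.EqOn (K.fn p) 0 (openPart D K) :=
    Measure.eqOn_open_of_ae_eq h hU (K.continuous_fn p).continuousOn continuousOn_const
  filter_upwards [ae_restrict_mem hU.measurableSet] with x hx
  exact (hzero.eventuallyEq_of_mem (hU.mem_nhds hx)).gradient_eq.trans (gradient_const x 0)

end ElementGradient

theorem exists_norm_le_mul_norm_of_ker_le {P E F : Type*} [AddCommGroup P] [Module ℝ P]
    [FiniteDimensional ℝ P] [NormedAddCommGroup E] [NormedSpace ℝ E] [NormedAddCommGroup F]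
    [NormedSpace ℝ F] (A : P →ₗ[ℝ] E) (B : P →ₗ[ℝ] F) (h : LinearMap.ker A ≤ LinearMap.ker B) :
    ∃ c : ℝ, 0 ≤ c ∧ ∀ p, ‖B p‖ ≤ c * ‖A p‖ := by
  let G := LinearMap.toContinuousLinearMap
    ((LinearMap.ker A).liftQ B h ∘ₗ A.quotKerEquivRange.symm.toLinearMap)
  have hG : ∀ p, G (A.rangeRestrict p) = B p := fun p => by
    have : A.quotKerEquivRange.symm (A.rangeRestrict p) = (LinearMap.ker A).mkQ p :=
      (LinearEquiv.symm_apply_eq _).2 rfl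
    simp [G, this]
  exact ⟨‖G‖, norm_nonneg G, fun p => hG p ▸ G.le_opNorm (A.rangeRestrict p)⟩

section InverseEstimate
variable {d : ℕ} {D : Problem d}

theorem DegreeLE.mem_restrictDegree {S : Family} {κ : RefKind} {k : ℕ}
    {p : MvPolynomial (Fin d) ℝ} (h : DegreeLE S κ k p) :
    p ∈ MvPolynomial.restrictDegree (Fin d) ℝ k := by
  have hdeg : ∀ i, p.degreeOf i ≤ k := by
    cases S <;> cases κ
    case Q.cube => exact h
    all_goals exact fun i => (p.degreeOf_le_totalDegree i).trans h
  rw [MvPolynomial.mem_restrictDegree]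
  exact fun s hs i => (MvPolynomial.monomial_le_degreeOf i hs).trans (hdeg i)

/-- `p ↦ p ∘ F_K⁻¹` as a map into `L²` of the element. -/
noncomputable def fnToL2 (D : Problem d) (K : Cell d) :
    MvPolynomial (Fin d) ℝ →ₗ[ℝ] Lp ℝ 2 (D.vol K.carrier) where
  toFun p := (D.memLp_of_continuous (K.continuous_fn p) 2 K.carrier).toLp
  map_add' p q := by
    simp only [K.fn_add]
    exact MemLp.toLp_add _ _
  map_smul' c p := by
    simp only [K.fn_smul]
    exact MemLp.toLp_const_smul _ _

/-- `p ↦ ∇(p ∘ F_K⁻¹)` as a map into `L²` of the element. -/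
noncomputable def gradientToL2 (D : Problem d) (K : Cell d) :
    MvPolynomial (Fin d) ℝ →ₗ[ℝ] Lp (Vec d) 2 (D.vol K.carrier) where
  toFun p := (D.memLp_of_continuous (K.continuous_gradient_fn p) 2 K.carrier).toLp
  map_add' p q := by
    simp only [K.gradient_fn_add]
    exact MemLp.toLp_add _ _
  map_smul' c p := by
    simp only [K.gradient_fn_smul]
    exact MemLp.toLp_const_smul _ _

theorem coeFn_fnToL2 (K : Cell d) (p : MvPolynomial (Fin d) ℝ) :
    fnToL2 D K p =ᵐ[D.vol K.carrier] K.fn p :=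
  (D.memLp_of_continuous (K.continuous_fn p) 2 K.carrier).coeFn_toLp

theorem coeFn_gradientToL2 (K : Cell d) (p : MvPolynomial (Fin d) ℝ) :
    gradientToL2 D K p =ᵐ[D.vol K.carrier] ∇ (K.fn p) :=
  (D.memLp_of_continuous (K.continuous_gradient_fn p) 2 K.carrier).coeFn_toLp

theorem ker_fnToL2_le (K : Cell d) :
    LinearMap.ker (fnToL2 D K) ≤ LinearMap.ker (gradientToL2 D K) := fun p hp => by
  have hfn : K.fn p =ᵐ[D.vol K.carrier] 0 :=
    (coeFn_fnToL2 K p).symm.trans (Lp.eq_zero_iff_ae_eq_zero.1 (LinearMap.mem_ker.1 hp))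
  exact LinearMap.mem_ker.2 <| Lp.eq_zero_iff_ae_eq_zero.2 <|
    (coeFn_gradientToL2 K p).trans (gradient_fn_ae_eq_zero hfn)

theorem exists_normL2_gradient_fn_le (D : Problem d) (K : Cell d) (k : ℕ) :
    ∃ c : ℝ, 0 ≤ c ∧ ∀ p ∈ MvPolynomial.restrictDegree (Fin d) ℝ k,
      normL2 (D.vol K.carrier) (∇ (K.fn p)) ≤ c * normL2 (D.vol K.carrier) (K.fn p) := by
  let W := MvPolynomial.restrictDegree (Fin d) ℝ k
  obtain ⟨c, hc0, hc⟩ := exists_norm_le_mul_norm_of_ker_le ((fnToL2 D K).domRestrict W)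
    ((gradientToL2 D K).domRestrict W) fun p hp => ker_fnToL2_le K hp
  refine ⟨c, hc0, fun p hp => ?_⟩
  rw [← normL2_congr_ae (coeFn_fnToL2 K p), ← normL2_congr_ae (coeFn_gradientToL2 K p)]
  exact hc ⟨p, hp⟩

theorem exists_inverseEstimate {ι : Type} [Finite ι] (hd : 0 < d) (T : ι → Cell d)
    (D : Problem d) (S : Family) : ∃ cI : ℝ, InverseEstimate T D S cI := by
  choose c hc0 hc using fun i => exists_normL2_gradient_fn_le D (T i) 1
  have hh := fun i => (T i).h_pos hd
  obtain ⟨M, hM⟩ := (Set.finite_range fun i => c i * (T i).h).bddAbove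
  refine ⟨M, ?_⟩
  rintro w ⟨p, hp, -, hr⟩ i
  have hcM : c i ≤ M * (T i).h⁻¹ := by
    rw [← div_eq_mul_inv, le_div_iff₀ (hh i)]
    exact hM (Set.mem_range_self i)
  calc normL2 (D.vol (T i).carrier) (gradOf w)
      = normL2 (D.vol (T i).carrier) (∇ ((T i).fn (p i))) :=
        normL2_congr_ae (gradOf_ae_eq_gradient_fn (hr i))
    _ ≤ c i * normL2 (D.vol (T i).carrier) ((T i).fn (p i)) := hc i _ (hp i).mem_restrictDegree
    _ = c i * normL2 (D.vol (T i).carrier) (fnOf w) := by rw [normL2_congr_ae (hr i)]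
    _ ≤ M * (T i).h⁻¹ * normL2 (D.vol (patch T (T i).carrier)) (fnOf w) :=
        mul_le_mul hcM
          (normL2_mono_measure ((D.memLp_fnOf w).restrict _) (vol_carrier_le_patch i))
          (normL2_nonneg _ _) ((hc0 i).trans hcM)

end InverseEstimate

section Residual
variable {d : ℕ}

theorem continuous_laplacian {φ : Vec d → ℝ} (h : ContDiff ℝ 2 φ) : Continuous (Δ φ) := by
  rw [InnerProductSpace.laplacian_eq_iteratedFDeriv_stdOrthonormalBasis]
  have := h.continuous_iteratedFDeriv (m := 2) le_rfl
  fun_prop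

variable {ι : Type} {T : ι → Cell d} {S : Family} {m : ℕ}

/-- The residual of the strong form of the differential equation on the element `T i`, with the
data replaced by their approximations; `p` are the polynomial pieces of `u_T`. -/
noncomputable def discreteResidual (D : Problem d) (A : DataApprox T S m)
    (p : ι → MvPolynomial (Fin d) ℝ) (i : ι) (x : Vec d) : ℝ :=
  (T i).fn (A.f i) x + D.ε * Δ ((T i).fn (p i)) x - ⟪A.aFn i x, ∇ ((T i).fn (p i)) x⟫_ℝ
    - (T i).fn (A.b i) x * (T i).fn (p i) x

/-- The part of the element residual on `T i` which is due to the approximation of the data, so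
that `discreteResidual + dataError = f + ε Δu_T - a·∇u_T - b u_T` on `T i`. -/
noncomputable def dataError (D : Problem d) (A : DataApprox T S m)
    (p : ι → MvPolynomial (Fin d) ℝ) (i : ι) (x : Vec d) : ℝ :=
  D.f x - (T i).fn (A.f i) x + ⟪A.aFn i x - D.a x, ∇ ((T i).fn (p i)) x⟫_ℝ
    + ((T i).fn (A.b i) x - D.b x) * (T i).fn (p i) x

variable (D : Problem d) (A : DataApprox T S m) (p : ι → MvPolynomial (Fin d) ℝ) (i : ι)

theorem discreteResidual_add_dataError (x : Vec d) :
    discreteResidual D A p i x + dataError D A p i x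
      = D.f x + D.ε * Δ ((T i).fn (p i)) x - ⟪D.a x, ∇ ((T i).fn (p i)) x⟫_ℝ
        - D.b x * (T i).fn (p i) x := by
  simp only [discreteResidual, dataError, inner_sub_left]
  ring

theorem DataApprox.continuous_aFn : Continuous (A.aFn i) :=
  (PiLp.continuous_toLp 2 _).comp (continuous_pi fun j => (T i).continuous_fn (A.a j i))

theorem memLp_discreteResidual : MemLp (discreteResidual D A p i) 2 (D.vol (T i).carrier) := by
  refine D.memLp_of_continuous ?_ 2 _
  have hlap := continuous_laplacian (contDiff_infty.1 ((T i).contDiff_fn (p i)) 2)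
  have hconv := (A.continuous_aFn i).inner (𝕜 := ℝ) ((T i).continuous_gradient_fn (p i))
  have hfn := (T i).continuous_fn
  exact (((hfn _).add (hlap.const_mul _)).sub hconv).sub ((hfn _).mul (hfn _))

theorem memLp_dataError : MemLp (dataError D A p i) 2 (D.vol (T i).carrier) := by
  have hle := D.vol_le (T i).carrier
  have hfn := fun q r => D.memLp_of_continuous ((T i).continuous_fn r) q (T i).carrier
  have hgrad := D.memLp_of_continuous ((T i).continuous_gradient_fn (p i)) 2 (T i).carrier
  have hf := (D.memLp_f.mono_measure hle).sub (hfn 2 (A.f i))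
  have ha := (D.memLp_of_continuous (A.continuous_aFn i) ⊤ _).sub (D.memLp_a.mono_measure hle)
  have hb := (hfn ⊤ (A.b i)).sub (D.memLp_b.mono_measure hle)
  exact (hf.add (memLp_inner ha hgrad)).add ((hfn 2 (p i)).mul hb)

theorem facet_term_nonneg (F : Set (Vec d)) (f : Vec d → ℝ) :
    0 ≤ D.ε ^ (-(1 / 2) : ℝ) * D.hbar F * normL2 ((surf d).restrict F) f ^ 2 :=
  mul_nonneg (mul_nonneg (Real.rpow_nonneg D.ε_pos.le _) (D.hbar_nonneg F)) (sq_nonneg _)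

theorem hbar_mul_normL2_dataError_le_theta :
    D.hbar (T i).carrier * normL2 (D.vol (T i).carrier) (dataError D A p i) ≤ theta D A p i := by
  refine Real.le_sqrt_of_sq_le ?_
  rw [mul_pow]
  exact le_add_of_nonneg_right (Finset.sum_nonneg fun F _ => facet_term_nonneg D F _)

theorem abs_integral_stabilization_le (v : D.V) :
    |∫ x, (-D.ε * Δ ((T i).fn (p i)) x + ⟪D.a x, ∇ ((T i).fn (p i)) x⟫_ℝ
        + D.b x * (T i).fn (p i) x - D.f x) * ⟪D.a x, gradOf v x⟫_ℝ ∂(D.vol (T i).carrier)|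
      ≤ (normL2 (D.vol (T i).carrier) (discreteResidual D A p i)
          + normL2 (D.vol (T i).carrier) (dataError D A p i)) *
        (normLinf (D.vol (T i).carrier) D.a * normL2 (D.vol (T i).carrier) (gradOf v)) := by
  have hle := D.vol_le (T i).carrier
  have hres := memLp_discreteResidual D A p i
  have herr := memLp_dataError D A p i
  have ha := D.memLp_a.mono_measure hle
  have hv := (D.memLp_gradOf v).mono_measure hle
  have hsplit : ∀ x, -D.ε * Δ ((T i).fn (p i)) x + ⟪D.a x, ∇ ((T i).fn (p i)) x⟫_ℝ
      + D.b x * (T i).fn (p i) x - D.f x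
      = -(discreteResidual D A p i + dataError D A p i) x := fun x => by
    rw [Pi.add_apply, discreteResidual_add_dataError]
    ring
  simp only [hsplit]
  simp only [neg_mul, integral_neg, abs_neg]
  refine (abs_integral_mul_le (hres.add herr) (memLp_inner ha hv)).trans ?_
  exact mul_le_mul (normL2_add_le hres herr) (normL2_inner_le ha hv) (normL2_nonneg _ _)
    (add_nonneg (normL2_nonneg _ _) (normL2_nonneg _ _))

variable [Fintype ι]

theorem hbar_mul_normL2_discreteResidual_le_eta :
    D.hbar (T i).carrier * normL2 (D.vol (T i).carrier) (discreteResidual D A p i)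
      ≤ eta D A p i := by
  refine Real.le_sqrt_of_sq_le ?_
  rw [mul_pow, add_assoc]
  exact le_add_of_nonneg_right <| add_nonneg
    (mul_nonneg one_half_pos.le (Finset.sum_nonneg fun F _ => facet_term_nonneg D F _))
    (Finset.sum_nonneg fun F _ => facet_term_nonneg D F _)

theorem hbar_mul_normL2_add_normL2_le_sqrt :
    D.hbar (T i).carrier * (normL2 (D.vol (T i).carrier) (discreteResidual D A p i)
        + normL2 (D.vol (T i).carrier) (dataError D A p i))
      ≤ √(2 * (eta D A p i ^ 2 + theta D A p i ^ 2)) := by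
  rw [mul_add]
  exact (add_le_add (hbar_mul_normL2_discreteResidual_le_eta D A p i)
    (hbar_mul_normL2_dataError_le_theta D A p i)).trans (Real.le_sqrt_of_sq_le (add_sq_le ..))

end Residual

section Stabilization
variable {d : ℕ} {ι : Type} [Fintype ι] {T : ι → Cell d} {D : Problem d} {S : Family}
  {I : D.V → D.V} {s₀ s₁ cS cI : ℝ} {ϑ : ι → ℝ} {m : ℕ}

/-- The constant `c` of the estimate, in terms of the stability constants `s₀, s₁` of the
interpolation operator and of the shape parameter `σ`. Its last factor bounds the number of
neighbours of an element. -/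
noncomputable def consistencyConst (d : ℕ) (cS s₀ s₁ cI σ : ℝ) : ℝ :=
  |cS| * max s₁ |cI * s₀| * √2 * (2 ^ d * (4 * σ) ^ d)

theorem consistencyConst_nonneg {σ : ℝ} (hσ : 0 ≤ σ) : 0 ≤ consistencyConst d cS s₀ s₁ cI σ := by
  have : 0 ≤ max s₁ |cI * s₀| := le_max_of_le_right (abs_nonneg _)
  unfold consistencyConst
  positivity

theorem abs_mul_integral_stabilization_le (hd : 0 < d) (hI : IsLocallyStable T D S I s₀ s₁)
    (hinv : InverseEstimate T D S cI) (hϑ : ∀ i, 0 ≤ ϑ i)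
    (hcS : ∀ i, ϑ i * normLinf (D.vol (T i).carrier) D.a ≤ cS * (T i).h) (A : DataApprox T S m)
    (p : ι → MvPolynomial (Fin d) ℝ) (v : D.V) (i : ι) :
    |ϑ i * ∫ x, (-D.ε * Δ ((T i).fn (p i)) x + ⟪D.a x, ∇ ((T i).fn (p i)) x⟫_ℝ
        + D.b x * (T i).fn (p i) x - D.f x) * ⟪D.a x, gradOf (I v) x⟫_ℝ ∂(D.vol (T i).carrier)|
      ≤ |cS| * max s₁ |cI * s₀| *
        (√(2 * (eta D A p i ^ 2 + theta D A p i ^ 2)) * √(energyNear T v i)) := by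
  have : 0 ≤ max s₁ |cI * s₀| := le_max_of_le_right (abs_nonneg _)
  set r := normL2 (D.vol (T i).carrier) (discreteResidual D A p i)
    + normL2 (D.vol (T i).carrier) (dataError D A p i)
  have hr : 0 ≤ r := add_nonneg (normL2_nonneg _ _) (normL2_nonneg _ _)
  set G := normL2 (D.vol (T i).carrier) (gradOf (I v))
  have hG : 0 ≤ G := normL2_nonneg _ _
  have hϑa : ϑ i * normLinf (D.vol (T i).carrier) D.a ≤ |cS| * (T i).h :=
    (hcS i).trans (mul_le_mul_of_nonneg_right (le_abs_self _) ((T i).h_pos hd).le)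
  rw [abs_mul, abs_of_nonneg (hϑ i)]
  calc _ ≤ ϑ i * (r * (normLinf (D.vol (T i).carrier) D.a * G)) :=
        mul_le_mul_of_nonneg_left (abs_integral_stabilization_le D A p i (I v)) (hϑ i)
    _ = r * ((ϑ i * normLinf (D.vol (T i).carrier) D.a) * G) := by ring
    _ ≤ r * ((|cS| * (T i).h) * G) := by gcongr
    _ = |cS| * r * ((T i).h * G) := by ring
    _ ≤ |cS| * r * (max s₁ |cI * s₀| * √(energyNear T v i) * D.hbar (T i).carrier) := by
        exact mul_le_mul_of_nonneg_left (hI.h_mul_normL2_gradOf_le hd hinv v i) (by positivity)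
    _ = |cS| * max s₁ |cI * s₀| * ((D.hbar (T i).carrier * r) * √(energyNear T v i)) := by ring
    _ ≤ _ := by
        gcongr
        exact hbar_mul_normL2_add_normL2_le_sqrt D A p i

theorem abs_sdfemTerm_le (hd : 0 < d) (hT : IsPartition D.Ω D.ΓD T)
    (hI : IsLocallyStable T D S I s₀ s₁) (hinv : InverseEstimate T D S cI) (hϑ : ∀ i, 0 ≤ ϑ i)
    (hcS : ∀ i, ϑ i * normLinf (D.vol (T i).carrier) D.a ≤ cS * (T i).h) (A : DataApprox T S m)
    (p : ι → MvPolynomial (Fin d) ℝ) (v : D.V) :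
    |sdfemTerm T D ϑ p (I v)| ≤ consistencyConst d cS s₀ s₁ cI (shapeParam T) *
      √(∑ i, (eta D A p i ^ 2 + theta D A p i ^ 2)) * D.normE v := by
  set M := max s₁ |cI * s₀|
  have : 0 ≤ M := le_max_of_le_right (abs_nonneg _)
  set N := 2 ^ d * (4 * shapeParam T) ^ d
  have hN : 0 ≤ N := by
    have := shapeParam_nonneg T
    positivity
  have henergy : √(∑ i, energyNear T v i) ≤ N * D.normE v :=
    Real.sqrt_le_iff.2 ⟨mul_nonneg hN (D.normE_nonneg v), sum_energyNear_le hd hT v⟩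
  calc |sdfemTerm T D ϑ p (I v)|
      ≤ ∑ i, |cS| * M * (√(2 * (eta D A p i ^ 2 + theta D A p i ^ 2)) * √(energyNear T v i)) :=
        (Finset.abs_sum_le_sum_abs _ _).trans <| Finset.sum_le_sum fun i _ =>
          abs_mul_integral_stabilization_le hd hI hinv hϑ hcS A p v i
    _ = |cS| * M * ∑ i, √(2 * (eta D A p i ^ 2 + theta D A p i ^ 2)) * √(energyNear T v i) := by
        rw [Finset.mul_sum]
    _ ≤ |cS| * M * (√(∑ i, 2 * (eta D A p i ^ 2 + theta D A p i ^ 2)) * (N * D.normE v)) := by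
        gcongr
        exact (Real.sum_sqrt_mul_sqrt_le _ (fun i => by positivity) (energyNear_nonneg v)).trans
          (by gcongr)
    _ = |cS| * M * √2 * N * √(∑ i, (eta D A p i ^ 2 + theta D A p i ^ 2)) * D.normE v := by
        rw [← Finset.mul_sum, Real.sqrt_mul zero_le_two]
        ring

end Stabilization

section Monotonicity
variable {d k l : ℕ} {S : Family}

theorem DegreeLE.mono (hkl : k ≤ l) {κ : RefKind} {p : MvPolynomial (Fin d) ℝ}
    (h : DegreeLE S κ k p) : DegreeLE S κ l p :=
  match S, κ with
  | .Q, .cube => fun i => (h i).trans hkl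
  | .P, .cube | .P, .simplex | .Q, .simplex => le_trans (b := k) h hkl

theorem feSpaceD_mono {ι : Type} (T : ι → Cell d) (D : Problem d) (hkl : k ≤ l) :
    feSpaceD T D S k ⊆ feSpaceD T D S l := by
  rintro v ⟨p, hp, hcont, hrep⟩
  exact ⟨p, fun i => (hp i).mono hkl, hcont, hrep⟩

end Monotonicity

end ConvDiff

open ConvDiff in
theorem lemma2p2_general {d : ℕ} (hd : 0 < d) {D : Problem d} {ι : Type} [Fintype ι]
    {T : ι → Cell d} (hT : IsPartition D.Ω D.ΓD T) {S : Family} {cI : ℝ}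
    (hinv : InverseEstimate T D S cI) {ϑ : ι → ℝ} {cS : ℝ} (hϑ : ∀ i, 0 ≤ ϑ i)
    (hcS : ∀ i, ϑ i * normLinf (D.vol (T i).carrier) D.a ≤ cS * (T i).h)
    {u : D.V} {p : ι → MvPolynomial (Fin d) ℝ} (_ : IsRep T D p u)
    (hu : ∀ v ∈ feSpaceD T D S 1, D.B u v + sdfemTerm T D ϑ p v = D.ell v)
    {I : D.V → D.V} {s₀ s₁ : ℝ} (hI : IsLocallyStable T D S I s₀ s₁)
    {m : ℕ} (A : DataApprox T S m) :
    D.normDual (adjoint I (D.residual u)) ≤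
      ((consistencyConst d cS s₀ s₁ cI (shapeParam T) *
        √(∑ i, (eta D A p i ^ 2 + theta D A p i ^ 2)) : ℝ) : EReal) := by
  refine iSup_le fun v => EReal.coe_le_coe_iff.2 (div_le_of_le_mul₀ (D.normE_nonneg _)
    (mul_nonneg (consistencyConst_nonneg (shapeParam_nonneg T)) (Real.sqrt_nonneg _)) ?_)
  have hres : adjoint I (D.residual u) v = sdfemTerm T D ϑ p (I v) :=
    (eq_sub_of_add_eq' (hu _ (hI.mem v))).symm
  exact hres ▸ (le_abs_self _).trans (abs_sdfemTerm_le hd hT hI hinv hϑ hcS A p v)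

open ConvDiff in
theorem lemma2p2 (d : ℕ) (hd : 2 ≤ d) :
    ∃ C : (cS c₁ c₂ c₃ c₄ cI σ : ℝ) → ℝ,
      ∀ (D : Problem d) (ι : Type) [Fintype ι] (T : ι → Cell d), IsPartition D.Ω D.ΓD T →
      ∀ S : Family,
        (∃ cI : ℝ, InverseEstimate T D S cI) ∧
        ∀ cI : ℝ, InverseEstimate T D S cI →
        ∀ (k l : ℕ), 1 ≤ k → k ≤ l →
        ∀ V : Submodule ℝ D.V,
          feSpaceD T D S k ⊆ (V : Set D.V) → (V : Set D.V) ⊆ feSpaceD T D S l →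
        ∀ (ϑ : ι → ℝ) (cS : ℝ), (∀ i, 0 ≤ ϑ i) →
          (∀ i, ϑ i * normLinf (D.vol (T i).carrier) D.a ≤ cS * (T i).h) →
        ∀ (u : D.V) (p : ι → MvPolynomial (Fin d) ℝ), u ∈ V → p ∈ PiecewisePoly T S l →
          IsRep T D p u →
          (∀ v ∈ V, D.B u v + sdfemTerm T D ϑ p v = D.ell v) →
        ∀ (I : D.V →ₗ[ℝ] D.V) (c₁ c₂ c₃ c₄ : ℝ), IsQuasiInterpolation T D S I c₁ c₂ c₃ c₄ →
        ∀ (m : ℕ) (A : DataApprox T S m),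
          D.normDual (adjoint I (D.residual u)) ≤
            ((C cS c₁ c₂ c₃ c₄ cI (shapeParam T) *
              √(∑ i, (eta D A p i ^ 2 + theta D A p i ^ 2)) : ℝ) : EReal) := by
  have hd₀ : 0 < d := by lia
  refine ⟨fun cS c₁ _ c₃ _ cI σ => consistencyConst d cS (1 + c₁) (1 + c₃) cI σ, ?_⟩
  intro D ι _ T hT S
  refine ⟨exists_inverseEstimate hd₀ T D S, ?_⟩
  intro cI hinv k _ hk _ V hkV _ ϑ cS hϑ hcS u p _ _ hp hu I c₁ c₂ c₃ c₄ hI m A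
  exact lemma2p2_general hd₀ hT hinv hϑ hcS hp (fun v hv => hu v (hkV (feSpaceD_mono T D hk hv)))
    hI.isLocallyStable A
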